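/- Let $M$ be a connected smooth manifold (Hausdorff, second countable, without boundary) of dimension $n$, and let $A$ be a second order locally uniformly elliptic linear differential operator on $M$ with locally bounded coefficients; that is, in local coordinates $(x_1,\dots,x_n)$, $$A=\sum_{i,j=1}^n a_{ij}\frac{\partial^2}{\partial x_i\partial x_j}+\sum_{i=1}^n b_i\frac{\partial}{\partial x_i}+c,$$ where $a_{ij}$, $b_i$ and $c$ are locally bounded real-valued functions (not assumed continuous) and $(a_{ij})$ is a symmetric matrix-valued function whose eigenvalues are locally bounded below by a positive constant. Suppose $K$ is a compact subset of $M$ such that no connected component of $M\setminus K$ is relatively compact in $M$, $\rho$ is a positive continuous function on $M$, and $W$ is a neighborhood of $K$ in $M$. Then there exists a $C^\infty$ function $\varphi$ on $M$ such that (i) $\varphi\ge 0$ and $A\varphi\ge 0$ on $M$; (ii) $\varphi>\rho$ and $A\varphi>\rho$ on $M\setminus W$; (iii) $\varphi\equiv 0$ on $K$; (iv) $\varphi>0$ on $M\setminus K$; and (v) for each compact set $E\subset M\setminus K$ there is a constant $\delta=\delta(\varphi,E)>0$ with $A\varphi>\delta$ on $E$. -/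

import Mathlib

open Set Filter
open scoped Manifold ContDiff Topology

noncomputable section

/-- The partial derivative of `F` with respect to the `i`-th Euclidean coordinate. -/
def partialDeriv {n : ℕ} (i : Fin n) (F : EuclideanSpace ℝ (Fin n) → ℝ) :
    EuclideanSpace ℝ (Fin n) → ℝ :=
  fun y => fderiv ℝ F y (EuclideanSpace.single i 1)

/-- A real-valued function is locally bounded on `s`: each point of `s` has a neighborhood in `s`
on which the function is bounded. (Neither continuity nor measurability is required.) -/
def LocallyBoundedOn {X : Type*} [TopologicalSpace X] (u : X → ℝ) (s : Set X) : Prop :=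
  ∀ y ∈ s, ∃ C : ℝ, ∀ᶠ z in 𝓝[s] y, |u z| ≤ C

/-- The eigenvalues of the matrix-valued function `a` are locally bounded below on `s` by positive
constants. -/
def EigenvaluesLocallyPositiveOn {X : Type*} [TopologicalSpace X] {n : ℕ}
    (a : X → Matrix (Fin n) (Fin n) ℝ) (s : Set X) : Prop :=
  ∀ y ∈ s, ∃ l : ℝ, 0 < l ∧ ∀ᶠ z in 𝓝[s] y,
    ∀ μ : ℝ, Module.End.HasEigenvalue (Matrix.toLin' (a z)) μ → l ≤ μ

/-- The value at `y` of `∑ a_ij ∂²F/∂x_i∂x_j + ∑ b_i ∂F/∂x_i + c F`. -/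
def secondOrderExpr {n : ℕ}
    (a : EuclideanSpace ℝ (Fin n) → Matrix (Fin n) (Fin n) ℝ)
    (b : EuclideanSpace ℝ (Fin n) → Fin n → ℝ)
    (c : EuclideanSpace ℝ (Fin n) → ℝ)
    (F : EuclideanSpace ℝ (Fin n) → ℝ) (y : EuclideanSpace ℝ (Fin n)) : ℝ :=
  (∑ i, ∑ j, a y i j * partialDeriv i (partialDeriv j F) y)
    + (∑ i, b y i * partialDeriv i F y) + c y * F y

/-- `A` is a second order locally uniformly elliptic linear differential operator with locally
bounded real coefficients on the smooth manifold `M`, acting on smooth functions: in every smooth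
coordinate chart `e` of `M` it is given by
`∑ a_ij ∂²/∂x_i∂x_j + ∑ b_i ∂/∂x_i + c` with `a_ij`, `b_i`, `c` locally bounded and `(a_ij)`
symmetric with eigenvalues locally bounded below by a positive constant. -/
def IsLocallyUniformlyElliptic {n : ℕ} {M : Type*} [TopologicalSpace M]
    [ChartedSpace (EuclideanSpace ℝ (Fin n)) M]
    (A : C^∞⟮𝓡 n, M; ℝ⟯ →ₗ[ℝ] (M → ℝ)) : Prop :=
  ∀ e ∈ IsManifold.maximalAtlas (𝓡 n) ∞ M,
    ∃ (a : EuclideanSpace ℝ (Fin n) → Matrix (Fin n) (Fin n) ℝ)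
      (b : EuclideanSpace ℝ (Fin n) → Fin n → ℝ)
      (c : EuclideanSpace ℝ (Fin n) → ℝ),
      (∀ i j, LocallyBoundedOn (fun y => a y i j) e.target) ∧
      (∀ i, LocallyBoundedOn (fun y => b y i) e.target) ∧
      LocallyBoundedOn c e.target ∧
      (∀ y ∈ e.target, (a y).IsSymm) ∧
      EigenvaluesLocallyPositiveOn a e.target ∧
      ∀ (f : C^∞⟮𝓡 n, M; ℝ⟯), ∀ x ∈ e.source,
        A f x = secondOrderExpr a b c (fun y => f (e.symm y)) (e x)

end

/-! In a coordinate ball, `exp (-1 / (μ (R² - ‖y - z‖²)))` with `μ` small satisfies `A α ≥ κ α` off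
a core ball around the centre. Near the edge the second-order term, nonnegative by ellipticity,
dominates the drift and `c`, whatever the sign of `c`. The core may be as small as desired, so a
nonnegative bump has its failure `A α < 0` confined near one chosen point (`exists_ball_barrier`).

The failure can be moved. If `β` is strict where `α` fails, then `α` plus a large multiple of `β`
fails only where `β` does. Chaining balls inside a connected open set transports the failure from
`p` to any other point `q` (`pushable`).

The hypothesis on `K` lets the failure be moved to infinity. Exhaust `M` by compact sets whose
complements also have no relatively compact component. From a point off `K` there is then a sequence
leaving every compact set, consecutive points being joined outside larger and larger members of the
exhaustion. Pushing along it and summing gives a locally finite series whose negative parts cancel: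
a global subsolution, zero on `K` and strict near the given point (`exists_subsolution`).

Countably many of these, with rapidly decreasing weights, sum to a subsolution positive and locally
strict off `K`. Large ones attached to compact shells sum locally finitely to one dominating `ρ` off
`W`. Adding the two gives the theorem. -/

/-- The radial function `exp (-1 / (μ (R² - ‖y - z‖²)))`, extended by zero outside the ball of
radius `R` around `z`. -/
noncomputable def radialBarrier {n : ℕ} (z : EuclideanSpace ℝ (Fin n)) (R μ : ℝ)
    (y : EuclideanSpace ℝ (Fin n)) : ℝ :=
  expNegInvGlue (μ * (R ^ 2 - ‖y - z‖ ^ 2))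

/-! ### The radial barrier in Euclidean space -/

section Barrier

variable {n : ℕ} (z : EuclideanSpace ℝ (Fin n)) (R μ : ℝ)

lemma contDiff_radialBarrier : ContDiff ℝ ∞ (radialBarrier z R μ) := by
  have h : ContDiff ℝ ∞ (fun y : EuclideanSpace ℝ (Fin n) => μ * (R ^ 2 - ‖y - z‖ ^ 2)) :=
    contDiff_const.mul (contDiff_const.sub ((contDiff_id.sub contDiff_const).norm_sq ℝ))
  exact expNegInvGlue.contDiff.comp h

lemma radialBarrier_nonneg (y : EuclideanSpace ℝ (Fin n)) : 0 ≤ radialBarrier z R μ y :=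
  expNegInvGlue.nonneg _

lemma radialBarrier_pos_iff {R μ : ℝ} (hR : 0 < R) (hμ : 0 < μ) (y : EuclideanSpace ℝ (Fin n)) :
    0 < radialBarrier z R μ y ↔ y ∈ Metric.ball z R := by
  rw [Metric.mem_ball, dist_eq_norm]
  constructor
  · intro h
    by_contra! hc
    have : μ * (R ^ 2 - ‖y - z‖ ^ 2) ≤ 0 := by
      have : R ^ 2 ≤ ‖y - z‖ ^ 2 := by gcongr
      nlinarith
    exact h.ne' (expNegInvGlue.zero_of_nonpos this)
  · intro h
    apply expNegInvGlue.pos_of_pos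
    have : ‖y - z‖ ^ 2 < R ^ 2 := by gcongr
    exact mul_pos hμ (by linarith)

lemma hasDerivAt_expNegInvGlue (t : ℝ) :
    HasDerivAt expNegInvGlue (t⁻¹ ^ 2 * expNegInvGlue t) t := by
  simpa using expNegInvGlue.hasDerivAt_polynomial_eval_inv_mul 1 t

lemma hasDerivAt_inv_sq_mul_expNegInvGlue (t : ℝ) :
    HasDerivAt (fun t => t⁻¹ ^ 2 * expNegInvGlue t)
      ((t⁻¹ ^ 4 - 2 * t⁻¹ ^ 3) * expNegInvGlue t) t := by
  have h := expNegInvGlue.hasDerivAt_polynomial_eval_inv_mul (Polynomial.X ^ 2) t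
  convert h using 1
  · simp
  · simp
    left
    ring

lemma hasFDerivAt_radial (y : EuclideanSpace ℝ (Fin n)) :
    HasFDerivAt (fun y : EuclideanSpace ℝ (Fin n) => μ * (R ^ 2 - ‖y - z‖ ^ 2))
      ((-2 * μ) • innerSL ℝ (y - z)) y := by
  have h := (((hasFDerivAt_id y).sub_const z).norm_sq.const_sub (R ^ 2)).const_mul μ
  refine h.congr_fderiv ?_
  ext v
  simp
  ring

lemma partialDeriv_radialBarrier (j : Fin n) :
    partialDeriv j (radialBarrier z R μ) = fun y => -2 * μ * (y j - z j) *
      ((μ * (R ^ 2 - ‖y - z‖ ^ 2))⁻¹ ^ 2 * expNegInvGlue (μ * (R ^ 2 - ‖y - z‖ ^ 2))) := by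
  ext y
  have h := (hasDerivAt_expNegInvGlue _).comp_hasFDerivAt y (hasFDerivAt_radial z R μ y)
  have h2 : HasFDerivAt (radialBarrier z R μ) _ y := h
  rw [partialDeriv, h2.fderiv]
  simp [EuclideanSpace.inner_single_right]
  ring

lemma partialDeriv_partialDeriv_radialBarrier (i j : Fin n) (y : EuclideanSpace ℝ (Fin n)) :
    partialDeriv i (partialDeriv j (radialBarrier z R μ)) y =
      4 * μ ^ 2 * ((y i - z i) * (y j - z j)) *
        (((μ * (R ^ 2 - ‖y - z‖ ^ 2))⁻¹ ^ 4 - 2 * (μ * (R ^ 2 - ‖y - z‖ ^ 2))⁻¹ ^ 3) *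
          expNegInvGlue (μ * (R ^ 2 - ‖y - z‖ ^ 2)))
      - 2 * μ * (if i = j then 1 else 0) *
        ((μ * (R ^ 2 - ‖y - z‖ ^ 2))⁻¹ ^ 2 * expNegInvGlue (μ * (R ^ 2 - ‖y - z‖ ^ 2))) := by
  rw [partialDeriv_radialBarrier]
  have h1 := (hasDerivAt_inv_sq_mul_expNegInvGlue _).comp_hasFDerivAt y
    (hasFDerivAt_radial z R μ y)
  have h0 : HasFDerivAt (fun y : EuclideanSpace ℝ (Fin n) => -2 * μ * (y j - z j))
      ((-2 * μ) • (EuclideanSpace.proj j : EuclideanSpace ℝ (Fin n) →L[ℝ] ℝ)) y :=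
    ((EuclideanSpace.proj j : EuclideanSpace ℝ (Fin n) →L[ℝ] ℝ).hasFDerivAt.sub_const
      (z j)).const_mul (-2 * μ)
  have h2 := h0.mul h1
  rw [partialDeriv]
  erw [h2.fderiv]
  simp [EuclideanSpace.inner_single_right, eq_comm (a := j), -inv_pow, -mul_inv_rev]
  generalize μ * (R ^ 2 - ‖y - z‖ ^ 2) = t
  split_ifs <;> ring

/-- Each derivative of order at most two is a polynomial in `t⁻¹` and the coordinates times
`expNegInvGlue t`. This factor comes out, so the sign rests on the bracket. The formula also covers
`t ≤ 0`, where the factor vanishes. -/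
lemma secondOrderExpr_radialBarrier (a : EuclideanSpace ℝ (Fin n) → Matrix (Fin n) (Fin n) ℝ)
    (b : EuclideanSpace ℝ (Fin n) → Fin n → ℝ) (c : EuclideanSpace ℝ (Fin n) → ℝ)
    (y : EuclideanSpace ℝ (Fin n)) (t : ℝ) (ht : t = μ * (R ^ 2 - ‖y - z‖ ^ 2)) :
    secondOrderExpr a b c (radialBarrier z R μ) y =
      (4 * μ ^ 2 * (t⁻¹ ^ 4 - 2 * t⁻¹ ^ 3) *
          (∑ i, ∑ j, a y i j * ((y i - z i) * (y j - z j)))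
        - 2 * μ * t⁻¹ ^ 2 * (∑ i, a y i i + ∑ i, b y i * (y i - z i)) + c y) *
        expNegInvGlue t := by
  have e1 : ∑ i, ∑ j, a y i j * partialDeriv i (partialDeriv j (radialBarrier z R μ)) y =
      4 * μ ^ 2 * ((t⁻¹ ^ 4 - 2 * t⁻¹ ^ 3) * expNegInvGlue t) *
          (∑ i, ∑ j, a y i j * ((y i - z i) * (y j - z j)))
        - 2 * μ * (t⁻¹ ^ 2 * expNegInvGlue t) * ∑ i, a y i i := by
    have : ∀ i, a y i i = ∑ j, a y i j * (if i = j then 1 else 0) := by intro i; simp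
    simp_rw [partialDeriv_partialDeriv_radialBarrier, ← ht, this, Finset.mul_sum,
      ← Finset.sum_sub_distrib]
    exact Finset.sum_congr rfl fun i _ => Finset.sum_congr rfl fun j _ => by ring
  have e2 : ∑ i, b y i * partialDeriv i (radialBarrier z R μ) y =
      - 2 * μ * (t⁻¹ ^ 2 * expNegInvGlue t) * ∑ i, b y i * (y i - z i) := by
    simp_rw [partialDeriv_radialBarrier, ← ht, Finset.mul_sum]
    exact Finset.sum_congr rfl fun i _ => by ring
  rw [secondOrderExpr, e1, e2, radialBarrier, ← ht]
  ring

end Barrier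

/-- After multiplication by `t ^ 4` the leading term is of order `μ ^ 2`, while `t ≤ μ * S` makes
the other two of order at most `μ ^ 3`. -/
lemma exists_small_parameter {q C₁ C S : ℝ} (hq : 0 < q) (hC₁ : 0 ≤ C₁) (hC : 0 ≤ C)
    (hS : 0 < S) :
    ∃ μ > 0, ∃ κ > 0, ∀ t Q T c : ℝ, 0 < t → t ≤ μ * S → q ≤ Q → |T| ≤ C₁ → |c| ≤ C →
      κ ≤ 4 * μ ^ 2 * (t⁻¹ ^ 4 - 2 * t⁻¹ ^ 3) * Q - 2 * μ * t⁻¹ ^ 2 * T + c := by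
  have hden : 0 < 2 * S ^ 2 * C₁ + C * S ^ 4 + 1 := by positivity
  -- The bound `1 / (4 * S)` gives `1 - 2 * t ≥ 1 / 2`, so the leading term is at least `2 * μ ^ 2 *
  -- q`. The last bound keeps the errors below `μ ^ 2 * q`, and `μ ≤ 1` turns `μ ^ 4` into `μ ^ 3`.
  set μ := min 1 (min (1 / (4 * S)) (q / (2 * S ^ 2 * C₁ + C * S ^ 4 + 1))) with hμ
  have hμ0 : 0 < μ := by positivity
  have hμ1 : μ ≤ 1 := min_le_left _ _
  have hμS : μ * S ≤ 1 / 4 := by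
    have : μ ≤ 1 / (4 * S) := (min_le_right _ _).trans (min_le_left _ _)
    rw [le_div_iff₀ (by positivity)] at this
    linarith
  have hμq : μ * (2 * S ^ 2 * C₁ + C * S ^ 4) ≤ q := by
    have : μ ≤ q / (2 * S ^ 2 * C₁ + C * S ^ 4 + 1) := (min_le_right _ _).trans (min_le_right _ _)
    rw [le_div_iff₀ hden] at this
    linarith
  refine ⟨μ, hμ0, μ ^ 2 * q / (μ * S) ^ 4, by positivity, ?_⟩
  intro t Q T c ht htS hQ hT hc
  have h1 : 2 * μ ^ 2 * q ≤ 4 * μ ^ 2 * (1 - 2 * t) * Q := by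
    have : q ≤ 2 * (1 - 2 * t) * Q := by nlinarith
    nlinarith [sq_nonneg μ]
  have ht2 : t ^ 2 ≤ μ ^ 2 * S ^ 2 := by rw [← mul_pow]; gcongr
  have ht4 : t ^ 4 ≤ μ ^ 3 * S ^ 4 := by
    calc t ^ 4 ≤ (μ * S) ^ 4 := by gcongr
      _ = μ ^ 3 * S ^ 4 * μ := by ring
      _ ≤ μ ^ 3 * S ^ 4 * 1 := by gcongr
      _ = _ := by ring
  have h2 : 2 * μ * t ^ 2 * T ≤ 2 * μ * (μ ^ 2 * S ^ 2) * C₁ := by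
    calc 2 * μ * t ^ 2 * T ≤ 2 * μ * t ^ 2 * C₁ := by gcongr; exact (abs_le.1 hT).2
      _ ≤ _ := by gcongr
  have h3 : -(C * (μ ^ 3 * S ^ 4)) ≤ c * t ^ 4 := by
    have : -C * t ^ 4 ≤ c * t ^ 4 := by gcongr; exact (abs_le.1 hc).1
    have : C * t ^ 4 ≤ C * (μ ^ 3 * S ^ 4) := by gcongr
    linarith
  have h4 : μ ^ 2 * (μ * (2 * S ^ 2 * C₁ + C * S ^ 4)) ≤ μ ^ 2 * q := by gcongr
  have key : μ ^ 2 * q ≤ 4 * μ ^ 2 * (1 - 2 * t) * Q - 2 * μ * t ^ 2 * T + c * t ^ 4 := by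
    nlinarith
  have e : 4 * μ ^ 2 * (t⁻¹ ^ 4 - 2 * t⁻¹ ^ 3) * Q - 2 * μ * t⁻¹ ^ 2 * T + c =
      (4 * μ ^ 2 * (1 - 2 * t) * Q - 2 * μ * t ^ 2 * T + c * t ^ 4) / t ^ 4 := by
    field_simp
  rw [e]
  have : 0 ≤ μ ^ 2 * q := by positivity
  have : 0 ≤ 4 * μ ^ 2 * (1 - 2 * t) * Q - 2 * μ * t ^ 2 * T + c * t ^ 4 := this.trans key
  gcongr

/-- A radial barrier with small parameter is a strict subsolution on an annulus. -/
lemma exists_radialBarrier_subsolution {n : ℕ}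
    (a : EuclideanSpace ℝ (Fin n) → Matrix (Fin n) (Fin n) ℝ)
    (b : EuclideanSpace ℝ (Fin n) → Fin n → ℝ) (c : EuclideanSpace ℝ (Fin n) → ℝ)
    (z : EuclideanSpace ℝ (Fin n)) {r R l C : ℝ} (hr : 0 < r) (hrR : r < R) (hl : 0 < l)
    (hC : 0 ≤ C)
    (ha : ∀ y ∈ Metric.closedBall z R, ∀ i j, |a y i j| ≤ C)
    (hb : ∀ y ∈ Metric.closedBall z R, ∀ i, |b y i| ≤ C)
    (hc : ∀ y ∈ Metric.closedBall z R, |c y| ≤ C)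
    (hell : ∀ y ∈ Metric.closedBall z R, ∀ v : EuclideanSpace ℝ (Fin n),
      l * ‖v‖ ^ 2 ≤ ∑ i, ∑ j, a y i j * (v i * v j)) :
    ∃ μ > 0, ∃ κ > 0, ∀ y, y ∉ Metric.ball z r →
      κ * radialBarrier z R μ y ≤ secondOrderExpr a b c (radialBarrier z R μ) y := by
  have hR : 0 < R := hr.trans hrR
  -- Off the core the quadratic form at `y - z` is at least `l * r ^ 2`; `C₁` bounds the trace plus
  -- the drift term.
  obtain ⟨μ, hμ, κ, hκ, h⟩ := exists_small_parameter (q := l * r ^ 2) (C₁ := n * C + n * (C * R))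
    (C := C) (S := R ^ 2) (by positivity) (by positivity) hC (by positivity)
  refine ⟨μ, hμ, κ, hκ, fun y hyr => ?_⟩
  rw [secondOrderExpr_radialBarrier z R μ a b c y _ rfl, radialBarrier]
  by_cases hy : y ∈ Metric.ball z R
  · have hy' := Metric.ball_subset_closedBall hy
    rw [Metric.mem_ball, dist_eq_norm] at hy hyr
    apply mul_le_mul_of_nonneg_right _ (expNegInvGlue.nonneg _)
    apply h
    · have : ‖y - z‖ ^ 2 < R ^ 2 := by gcongr
      exact mul_pos hμ (by linarith)
    · gcongr
      nlinarith [sq_nonneg ‖y - z‖]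
    · refine le_trans ?_ (hell y hy' (y - z))
      gcongr
      exact not_lt.1 hyr
    · refine (abs_add_le _ _).trans (add_le_add ?_ ?_)
      · refine (Finset.abs_sum_le_sum_abs _ _).trans ?_
        refine (Finset.sum_le_sum fun i _ => ha y hy' i i).trans ?_
        simp
      · refine (Finset.abs_sum_le_sum_abs _ _).trans ?_
        refine (Finset.sum_le_sum (g := fun _ => C * R) fun i _ => ?_).trans ?_
        · rw [abs_mul]
          have : |y i - z i| ≤ R := by
            have := PiLp.norm_apply_le (y - z) i
            simp only [PiLp.sub_apply, Real.norm_eq_abs] at this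
            linarith
          gcongr
          exact hb y hy' i
        · simp
    · exact hc y hy'
  · have : μ * (R ^ 2 - ‖y - z‖ ^ 2) ≤ 0 := by
      rw [Metric.mem_ball, dist_eq_norm, not_lt] at hy
      have : R ^ 2 ≤ ‖y - z‖ ^ 2 := by gcongr
      nlinarith
    rw [expNegInvGlue.zero_of_nonpos this]
    simp

/-! ### Uniform constants on compact sets, and locality -/

lemma EigenvaluesLocallyPositiveOn.exists_bound {X : Type*} [TopologicalSpace X] {n : ℕ}
    {a : X → Matrix (Fin n) (Fin n) ℝ} {s : Set X} (h : EigenvaluesLocallyPositiveOn a s)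
    {S : Set X} (hS : IsCompact S) (hSs : S ⊆ s) :
    ∃ l : ℝ, 0 < l ∧ ∀ z ∈ S, ∀ μ : ℝ, Module.End.HasEigenvalue (Matrix.toLin' (a z)) μ →
      l ≤ μ := by
  refine hS.induction_on (p := fun S => ∃ l : ℝ, 0 < l ∧ ∀ z ∈ S, ∀ μ : ℝ,
    Module.End.HasEigenvalue (Matrix.toLin' (a z)) μ → l ≤ μ) ⟨1, one_pos, by simp⟩ ?_ ?_ ?_
  · rintro S T hST ⟨l, hl, h⟩
    exact ⟨l, hl, fun z hz => h z (hST hz)⟩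
  · rintro S T ⟨l, hl, h⟩ ⟨l', hl', h'⟩
    refine ⟨min l l', lt_min hl hl', ?_⟩
    rintro z (hz | hz) μ hμ
    · exact (min_le_left _ _).trans (h z hz μ hμ)
    · exact (min_le_right _ _).trans (h' z hz μ hμ)
  · intro x hx
    obtain ⟨l, hl, h⟩ := h x (hSs hx)
    exact ⟨_, nhdsWithin_mono x hSs h, l, hl, fun z hz => hz⟩

lemma LocallyBoundedOn.exists_bound {X : Type*} [TopologicalSpace X] {u : X → ℝ} {s : Set X}
    (h : LocallyBoundedOn u s) {S : Set X} (hS : IsCompact S) (hSs : S ⊆ s) :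
    ∃ C : ℝ, ∀ z ∈ S, |u z| ≤ C := by
  refine hS.induction_on (p := fun S => ∃ C : ℝ, ∀ z ∈ S, |u z| ≤ C) ⟨1, by simp⟩ ?_ ?_ ?_
  · rintro S T hST ⟨C, h⟩
    exact ⟨C, fun z hz => h z (hST hz)⟩
  · rintro S T ⟨C, h⟩ ⟨C', h'⟩
    refine ⟨max C C', ?_⟩
    rintro z (hz | hz)
    · exact (h z hz).trans (le_max_left _ _)
    · exact (h' z hz).trans (le_max_right _ _)
  · intro x hx
    obtain ⟨C, h⟩ := h x (hSs hx)
    exact ⟨_, nhdsWithin_mono x hSs h, C, fun z hz => hz⟩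

/-- An eigenvector of `a - l • 1` is one of `a` with eigenvalue shifted by `l`, so `a - l • 1` is
symmetric with nonnegative eigenvalues, hence positive semidefinite. -/
lemma quadraticForm_lower_bound {n : ℕ} {a : Matrix (Fin n) (Fin n) ℝ} (ha : a.IsSymm) {l : ℝ}
    (h : ∀ μ : ℝ, Module.End.HasEigenvalue (Matrix.toLin' a) μ → l ≤ μ)
    (v : EuclideanSpace ℝ (Fin n)) : l * ‖v‖ ^ 2 ≤ ∑ i, ∑ j, a i j * (v i * v j) := by
  have hH : (a - l • (1 : Matrix (Fin n) (Fin n) ℝ)).IsHermitian := by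
    rw [Matrix.IsHermitian, Matrix.conjTranspose_eq_transpose_of_trivial, Matrix.transpose_sub,
      ha.eq, Matrix.transpose_smul, Matrix.transpose_one]
  have hp : (a - l • (1 : Matrix (Fin n) (Fin n) ℝ)).PosSemidef := by
    rw [hH.posSemidef_iff_eigenvalues_nonneg]
    intro i
    have h0 := hH.mulVec_eigenvectorBasis i
    have := h (hH.eigenvalues i + l) ?_
    · simpa using this
    · refine Module.End.hasEigenvalue_of_hasEigenvector (x := (hH.eigenvectorBasis i).ofLp) ?_
      rw [Module.End.hasEigenvector_iff, Module.End.mem_eigenspace_iff]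
      constructor
      · rw [Matrix.sub_mulVec, Matrix.smul_mulVec, Matrix.one_mulVec, sub_eq_iff_eq_add] at h0
        rw [Matrix.toLin'_apply, h0, add_smul]
      · have := hH.eigenvectorBasis.orthonormal.ne_zero i
        simpa using this
  have := hp.dotProduct_mulVec_nonneg v.ofLp
  rw [Matrix.sub_mulVec, Matrix.smul_mulVec, Matrix.one_mulVec, dotProduct_sub] at this
  have e1 : star v.ofLp ⬝ᵥ a.mulVec v.ofLp = ∑ i, ∑ j, a i j * (v i * v j) := by
    simp only [dotProduct, Matrix.mulVec, Finset.mul_sum]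
    refine Finset.sum_congr rfl fun i _ => Finset.sum_congr rfl fun j _ => ?_
    simp
    ring
  have e2 : star v.ofLp ⬝ᵥ l • v.ofLp = l * ‖v‖ ^ 2 := by
    rw [EuclideanSpace.norm_sq_eq, dotProduct_smul]
    simp [dotProduct, pow_two]
  linarith

lemma partialDeriv_congr {n : ℕ} {F G : EuclideanSpace ℝ (Fin n) → ℝ}
    {y : EuclideanSpace ℝ (Fin n)} (h : F =ᶠ[𝓝 y] G) (i : Fin n) :
    partialDeriv i F =ᶠ[𝓝 y] partialDeriv i G := by
  filter_upwards [h.fderiv (𝕜 := ℝ)] with w hw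
  rw [partialDeriv, partialDeriv, hw]

lemma secondOrderExpr_congr {n : ℕ} (a : EuclideanSpace ℝ (Fin n) → Matrix (Fin n) (Fin n) ℝ)
    (b : EuclideanSpace ℝ (Fin n) → Fin n → ℝ) (c : EuclideanSpace ℝ (Fin n) → ℝ)
    {F G : EuclideanSpace ℝ (Fin n) → ℝ} {y : EuclideanSpace ℝ (Fin n)} (h : F =ᶠ[𝓝 y] G) :
    secondOrderExpr a b c F y = secondOrderExpr a b c G y := by
  have h1 : ∀ i, partialDeriv i F y = partialDeriv i G y := fun i =>
    (partialDeriv_congr h i).self_of_nhds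
  have h2 : ∀ i j, partialDeriv i (partialDeriv j F) y = partialDeriv i (partialDeriv j G) y :=
    fun i j => (partialDeriv_congr (partialDeriv_congr h j) i).self_of_nhds
  simp only [secondOrderExpr, h1, h2, h.self_of_nhds]

lemma comp_symm_eventuallyEq {n : ℕ} {M : Type*} [TopologicalSpace M]
    {e : OpenPartialHomeomorph M (EuclideanSpace ℝ (Fin n))}
    {f g : M → ℝ} {x : M} (hx : x ∈ e.source) (h : f =ᶠ[𝓝 x] g) :
    (fun y => f (e.symm y)) =ᶠ[𝓝 (e x)] fun y => g (e.symm y) := by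
  have ht := e.tendsto_symm hx
  exact ht.eventually h

/-! ### Transfer to the manifold -/

section Manifold

variable {n : ℕ} {M : Type*} [TopologicalSpace M] [ChartedSpace (EuclideanSpace ℝ (Fin n)) M]

lemma contDiffOn_comp_symm {e : OpenPartialHomeomorph M (EuclideanSpace ℝ (Fin n))}
    (he : e ∈ IsManifold.maximalAtlas (𝓡 n) ∞ M) (f : C^∞⟮𝓡 n, M; ℝ⟯) :
    ContDiffOn ℝ ∞ (fun y => f (e.symm y)) e.target := by
  rw [← contMDiffOn_iff_contDiffOn]
  exact f.contMDiff.comp_contMDiffOn (contMDiffOn_symm_of_mem_maximalAtlas he)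

/-- A smooth function on the target of a chart with compact support extends by zero. -/
lemma exists_smooth_zero_extension [T2Space M]
    {e : OpenPartialHomeomorph M (EuclideanSpace ℝ (Fin n))}
    (he : e ∈ IsManifold.maximalAtlas (𝓡 n) ∞ M) {g : EuclideanSpace ℝ (Fin n) → ℝ}
    (hg : ContDiff ℝ ∞ g) {S : Set (EuclideanSpace ℝ (Fin n))} (hS : IsCompact S)
    (hSe : S ⊆ e.target) (hgS : ∀ y ∉ S, g y = 0) :
    ∃ α : C^∞⟮𝓡 n, M; ℝ⟯, (∀ x ∈ e.source, α x = g (e x)) ∧ ∀ x ∉ e.source, α x = 0 := by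
  classical
  set α : M → ℝ := fun x => if x ∈ e.source then g (e x) else 0 with hα
  have hα1 : ∀ x ∈ e.source, α x = g (e x) := fun x hx => if_pos hx
  have hα2 : ∀ x ∉ e.source, α x = 0 := fun x hx => if_neg hx
  -- The image is closed because `M` is Hausdorff, so a point outside the chart has a neighborhood
  -- on which the extension vanishes.
  have hT : IsCompact (e.symm '' S) := hS.image_of_continuousOn (e.continuousOn_symm.mono hSe)
  have hsm : ContMDiff (𝓡 n) 𝓘(ℝ, ℝ) ∞ α := by
    intro x
    by_cases hx : x ∈ e.source
    · have h : ContMDiffAt (𝓡 n) 𝓘(ℝ, ℝ) ∞ (fun x => g (e x)) x :=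
        hg.contMDiff.contMDiffAt.comp x (contMDiffAt_of_mem_maximalAtlas he hx)
      refine h.congr_of_eventuallyEq ?_
      filter_upwards [e.open_source.mem_nhds hx] with w hw using hα1 w hw
    · refine (contMDiffAt_const (c := (0 : ℝ))).congr_of_eventuallyEq ?_
      have hxT : x ∉ e.symm '' S := by
        rintro ⟨y, hy, rfl⟩
        exact hx (e.map_target (hSe hy))
      filter_upwards [hT.isClosed.isOpen_compl.mem_nhds hxT] with w hw
      by_cases hws : w ∈ e.source
      · rw [hα1 w hws]
        refine hgS _ fun h => hw ⟨e w, h, e.left_inv hws⟩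
      · exact hα2 w hws
  exact ⟨⟨α, hsm⟩, hα1, hα2⟩

variable [IsManifold (𝓡 n) ∞ M] {A : C^∞⟮𝓡 n, M; ℝ⟯ →ₗ[ℝ] (M → ℝ)}

lemma IsLocallyUniformlyElliptic.apply_congr (hA : IsLocallyUniformlyElliptic A)
    {f g : C^∞⟮𝓡 n, M; ℝ⟯} {x : M} (h : f =ᶠ[𝓝 x] g) : A f x = A g x := by
  obtain ⟨a, b, c, -, -, -, -, -, hf⟩ := hA _ (IsManifold.chart_mem_maximalAtlas x)
  rw [hf f x (mem_chart_source _ x), hf g x (mem_chart_source _ x)]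
  exact secondOrderExpr_congr a b c (comp_symm_eventuallyEq (mem_chart_source _ x) h)

lemma IsLocallyUniformlyElliptic.apply_eq_zero (hA : IsLocallyUniformlyElliptic A)
    {f : C^∞⟮𝓡 n, M; ℝ⟯} {x : M} (h : ∀ᶠ y in 𝓝 x, f y = 0) : A f x = 0 := by
  have : A f x = A 0 x := hA.apply_congr h
  simpa using this

lemma contDiffOn_partialDeriv {F : EuclideanSpace ℝ (Fin n) → ℝ}
    {s : Set (EuclideanSpace ℝ (Fin n))} (hs : IsOpen s) (hF : ContDiffOn ℝ ∞ F s) (i : Fin n) :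
    ContDiffOn ℝ ∞ (partialDeriv i F) s := by
  have h := hF.fderiv_of_isOpen (m := ∞) hs (by simp)
  exact h.clm_apply contDiffOn_const

/-- The operator maps smooth functions to locally bounded functions. -/
lemma IsLocallyUniformlyElliptic.locallyBounded (hA : IsLocallyUniformlyElliptic A)
    (f : C^∞⟮𝓡 n, M; ℝ⟯) : LocallyBoundedOn (A f) univ := by
  intro x _
  set e := chartAt (EuclideanSpace ℝ (Fin n)) x with he
  have hxs : x ∈ e.source := mem_chart_source _ x
  obtain ⟨a, b, c, ha, hb, hc, -, -, hf⟩ := hA e (IsManifold.chart_mem_maximalAtlas x)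
  have hF := contDiffOn_comp_symm (IsManifold.chart_mem_maximalAtlas x) f
  set F : EuclideanSpace ℝ (Fin n) → ℝ := fun y => f (e.symm y) with hFdef
  have hx : e x ∈ e.target := e.map_source hxs
  -- The coefficients need not be continuous, so only boundedness near `e x` is carried through
  -- products and sums.
  have bdd : ∀ u : EuclideanSpace ℝ (Fin n) → ℝ, ContDiffOn ℝ ∞ u e.target →
      ∃ C, ∀ᶠ y in 𝓝 (e x), |u y| ≤ C := by
    intro u hu
    have hc : ContinuousAt (fun y => |u y|) (e x) :=
      (hu.continuousOn.continuousAt (e.open_target.mem_nhds hx)).abs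
    exact ⟨|u (e x)| + 1, hc.eventually_le_const (lt_add_one _)⟩
  have bdd' : ∀ u : EuclideanSpace ℝ (Fin n) → ℝ, LocallyBoundedOn u e.target →
      ∃ C, ∀ᶠ y in 𝓝 (e x), |u y| ≤ C := by
    intro u hu
    obtain ⟨C, hC⟩ := hu _ hx
    rw [e.open_target.nhdsWithin_eq hx] at hC
    exact ⟨C, hC⟩
  have hmul : ∀ u v : EuclideanSpace ℝ (Fin n) → ℝ, (∃ C, ∀ᶠ y in 𝓝 (e x), |u y| ≤ C) →
      (∃ C, ∀ᶠ y in 𝓝 (e x), |v y| ≤ C) → ∃ C, ∀ᶠ y in 𝓝 (e x), |u y * v y| ≤ C := by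
    rintro u v ⟨C, hu⟩ ⟨D, hv⟩
    refine ⟨C * D, ?_⟩
    filter_upwards [hu, hv] with y h1 h2
    rw [abs_mul]
    exact mul_le_mul h1 h2 (abs_nonneg _) ((abs_nonneg _).trans h1)
  have hadd : ∀ u v : EuclideanSpace ℝ (Fin n) → ℝ, (∃ C, ∀ᶠ y in 𝓝 (e x), |u y| ≤ C) →
      (∃ C, ∀ᶠ y in 𝓝 (e x), |v y| ≤ C) → ∃ C, ∀ᶠ y in 𝓝 (e x), |u y + v y| ≤ C := by
    rintro u v ⟨C, hu⟩ ⟨D, hv⟩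
    refine ⟨C + D, ?_⟩
    filter_upwards [hu, hv] with y h1 h2
    exact (abs_add_le _ _).trans (add_le_add h1 h2)
  have hsum : ∀ u : Fin n → EuclideanSpace ℝ (Fin n) → ℝ,
      (∀ i, ∃ C, ∀ᶠ y in 𝓝 (e x), |u i y| ≤ C) → ∃ C, ∀ᶠ y in 𝓝 (e x), |∑ i, u i y| ≤ C := by
    intro u hu
    choose C hC using hu
    refine ⟨∑ i, C i, ?_⟩
    filter_upwards [eventually_all.2 hC] with y hy
    exact (Finset.abs_sum_le_sum_abs _ _).trans (Finset.sum_le_sum fun i _ => hy i)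
  have key : ∃ C, ∀ᶠ y in 𝓝 (e x), |secondOrderExpr a b c F y| ≤ C := by
    unfold secondOrderExpr
    refine hadd _ _ (hadd _ _ (hsum _ fun i => hsum _ fun j => hmul _ _ (bdd' _ (ha i j))
      (bdd _ ?_)) (hsum _ fun i => hmul _ _ (bdd' _ (hb i)) (bdd _ ?_))) (hmul _ _ (bdd' _ hc)
      (bdd _ hF))
    · exact contDiffOn_partialDeriv e.open_target
        (contDiffOn_partialDeriv e.open_target hF j) i
    · exact contDiffOn_partialDeriv e.open_target hF i
  obtain ⟨C, hC⟩ := key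
  refine ⟨C, ?_⟩
  rw [nhdsWithin_univ]
  filter_upwards [(e.continuousAt hxs).eventually hC, e.open_source.mem_nhds hxs] with w hw hws
  rw [hf f w hws]
  exact hw

/-- A smooth bump supported in a coordinate ball which is a strict subsolution off the core. -/
lemma IsLocallyUniformlyElliptic.exists_ball_barrier [T2Space M]
    (hA : IsLocallyUniformlyElliptic A)
    {e : OpenPartialHomeomorph M (EuclideanSpace ℝ (Fin n))}
    (he : e ∈ IsManifold.maximalAtlas (𝓡 n) ∞ M) {z : EuclideanSpace ℝ (Fin n)} {r R : ℝ}
    (hr : 0 < r) (hrR : r < R) (hz : Metric.closedBall z R ⊆ e.target) :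
    ∃ α : C^∞⟮𝓡 n, M; ℝ⟯, (∀ x, 0 ≤ α x) ∧
      (∀ x, 0 < α x ↔ x ∈ e.source ∧ e x ∈ Metric.ball z R) ∧
      ∃ κ > 0, ∀ x, ¬ (x ∈ e.source ∧ e x ∈ Metric.ball z r) → κ * α x ≤ A α x := by
  have hR : 0 < R := hr.trans hrR
  obtain ⟨a, b, c, ha, hb, hc, hsym, hev, hf⟩ := hA e he
  have hcpt : IsCompact (Metric.closedBall z R) := isCompact_closedBall z R
  choose Ca hCa using fun i j => (ha i j).exists_bound hcpt hz
  choose Cb hCb using fun i => (hb i).exists_bound hcpt hz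
  obtain ⟨Cc, hCc⟩ := hc.exists_bound hcpt hz
  obtain ⟨l, hl, hlev⟩ := hev.exists_bound hcpt hz
  set C : ℝ := (∑ i, ∑ j, |Ca i j|) + (∑ i, |Cb i|) + |Cc| with hC
  have hsa : ∀ i j, |Ca i j| ≤ ∑ i, ∑ j, |Ca i j| := fun i j =>
    (Finset.single_le_sum (f := fun j => |Ca i j|) (fun _ _ => abs_nonneg _)
      (Finset.mem_univ j)).trans
    (Finset.single_le_sum (f := fun i => ∑ j, |Ca i j|)
      (fun _ _ => Finset.sum_nonneg fun _ _ => abs_nonneg _) (Finset.mem_univ i))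
  have hsb : ∀ i, |Cb i| ≤ ∑ i, |Cb i| := fun i =>
    Finset.single_le_sum (f := fun i => |Cb i|) (fun _ _ => abs_nonneg _) (Finset.mem_univ i)
  have hs1 : 0 ≤ ∑ i, ∑ j, |Ca i j| :=
    Finset.sum_nonneg fun _ _ => Finset.sum_nonneg fun _ _ => abs_nonneg _
  have hs2 : 0 ≤ ∑ i, |Cb i| := Finset.sum_nonneg fun _ _ => abs_nonneg _
  have hs3 := abs_nonneg Cc
  obtain ⟨μ, hμ, κ, hκ, hsub⟩ := exists_radialBarrier_subsolution a b c z hr hrR hl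
    (C := C) (by positivity)
    (fun y hy i j => by linarith [hCa i j y hy, le_abs_self (Ca i j), hsa i j])
    (fun y hy i => by linarith [hCb i y hy, le_abs_self (Cb i), hsb i])
    (fun y hy => by linarith [hCc y hy, le_abs_self Cc])
    (fun y hy v => quadraticForm_lower_bound (hsym y (hz hy)) (hlev y hy) v)
  have hg0 : ∀ y ∉ Metric.closedBall z R, radialBarrier z R μ y = 0 := by
    intro y hy
    have h1 := (radialBarrier_pos_iff z hR hμ y).not.2
      fun h => hy (Metric.ball_subset_closedBall h)
    exact le_antisymm (not_lt.1 h1) (radialBarrier_nonneg z R μ y)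
  obtain ⟨α, hα1, hα2⟩ := exists_smooth_zero_extension he (contDiff_radialBarrier z R μ) hcpt hz hg0
  refine ⟨α, fun x => ?_, fun x => ?_, κ, hκ, fun x hx => ?_⟩
  · by_cases hx : x ∈ e.source
    · rw [hα1 x hx]
      exact radialBarrier_nonneg z R μ _
    · rw [hα2 x hx]
  · by_cases hx : x ∈ e.source
    · rw [hα1 x hx, radialBarrier_pos_iff z hR hμ]
      simp [hx]
    · simp [hα2 x hx, hx]
  · by_cases hxs : x ∈ e.source
    · rw [hf α x hxs, hα1 x hxs]
      have : (fun y => α (e.symm y)) =ᶠ[𝓝 (e x)] radialBarrier z R μ := by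
        filter_upwards [e.open_target.mem_nhds (e.map_source hxs)] with y hy
        rw [hα1 _ (e.map_target hy), e.right_inv hy]
      rw [secondOrderExpr_congr a b c this]
      exact hsub _ fun h => hx ⟨hxs, h⟩
    · have hT : IsCompact (e.symm '' Metric.closedBall z R) :=
        hcpt.image_of_continuousOn (e.continuousOn_symm.mono hz)
      have hxT : x ∉ e.symm '' Metric.closedBall z R := by
        rintro ⟨y, hy, rfl⟩
        exact hxs (e.map_target (hz hy))
      rw [hA.apply_eq_zero, hα2 x hxs, mul_zero]
      filter_upwards [hT.isClosed.isOpen_compl.mem_nhds hxT] with w hw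
      by_cases hws : w ∈ e.source
      · rw [hα1 w hws]
        exact hg0 _ fun h => hw ⟨e w, h, e.left_inv hws⟩
      · exact hα2 w hws

end Manifold

/-! ### Moving the region of failure -/

section Manifold

variable {n : ℕ} {M : Type*} [TopologicalSpace M] [ChartedSpace (EuclideanSpace ℝ (Fin n)) M]

/-- Within `V`, the region where a nonnegative function fails to be a subsolution can be moved from
a fixed neighborhood of `p` into arbitrarily small neighborhoods of `q`. -/
def Pushable (A : C^∞⟮𝓡 n, M; ℝ⟯ →ₗ[ℝ] (M → ℝ)) (V : Set M) (p q : M) : Prop :=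
  p ≠ q → ∃ D ∈ 𝓝 p, ∀ N ∈ 𝓝 q, ∃ α : C^∞⟮𝓡 n, M; ℝ⟯, (∀ x, 0 ≤ α x) ∧
    (∃ S, IsCompact S ∧ S ⊆ V ∧ ∀ x ∉ S, α x = 0) ∧ (∀ x ∉ N, 0 ≤ A α x) ∧
    ∃ δ > 0, ∀ x ∈ D, δ ≤ α x ∧ δ ≤ A α x

variable [T2Space M] [IsManifold (𝓡 n) ∞ M] {A : C^∞⟮𝓡 n, M; ℝ⟯ →ₗ[ℝ] (M → ℝ)}

lemma IsLocallyUniformlyElliptic.exists_lower_bound (hA : IsLocallyUniformlyElliptic A)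
    (f : C^∞⟮𝓡 n, M; ℝ⟯) {S : Set M} (hS : IsCompact S) (hf : ∀ x ∉ S, f x = 0) :
    ∃ C ≥ 0, ∀ x, -C ≤ A f x := by
  obtain ⟨C, hC⟩ := (hA.locallyBounded f).exists_bound hS (subset_univ S)
  refine ⟨max C 0, le_max_right _ _, fun x => ?_⟩
  by_cases hx : x ∈ S
  · have := (abs_le.1 (hC x hx)).1
    linarith [le_max_left C 0]
  · rw [hA.apply_eq_zero]
    · linarith [le_max_right C 0]
    · filter_upwards [hS.isClosed.isOpen_compl.mem_nhds hx] with y hy using hf y hy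

/-- A barrier centred at `e q` works. The closed annulus `T` about `e q` is a neighborhood of `e p`
on which the barrier has a positive minimum. A core of radius at most `d / 2` misses the open region
outside its inner boundary, and a smaller one also fits in `N`. -/
lemma IsLocallyUniformlyElliptic.pushable_of_ball (hA : IsLocallyUniformlyElliptic A) {V : Set M}
    {e : OpenPartialHomeomorph M (EuclideanSpace ℝ (Fin n))}
    (he : e ∈ IsManifold.maximalAtlas (𝓡 n) ∞ M) {p q : M} {R : ℝ}
    (hp : p ∈ e.source) (hq : q ∈ e.source) (hpq : dist (e p) (e q) < R)
    (hR : Metric.closedBall (e q) R ⊆ e.target)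
    (hV : ∀ y ∈ Metric.closedBall (e q) R, e.symm y ∈ V) : Pushable A V p q := by
  intro hne
  set d := dist (e p) (e q) with hd
  have hd0 : 0 < d := dist_pos.2 fun h => hne (e.injOn hp hq h)
  set T : Set (EuclideanSpace ℝ (Fin n)) :=
    Metric.closedBall (e q) ((d + R) / 2) \ Metric.ball (e q) (d / 2) with hT
  have hTR : T ⊆ Metric.ball (e q) R := by
    rintro y ⟨hy, -⟩
    rw [Metric.mem_closedBall] at hy
    rw [Metric.mem_ball]
    linarith
  have hTt : T ⊆ e.target := hTR.trans (Metric.ball_subset_closedBall.trans hR)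
  have hTc : IsCompact T := (isCompact_closedBall _ _).diff Metric.isOpen_ball
  have hDc : IsCompact (e.symm '' T) := hTc.image_of_continuousOn (e.continuousOn_symm.mono hTt)
  have hTn : T ∈ 𝓝 (e p) := by
    have h1 : Metric.ball (e q) ((d + R) / 2) ∈ 𝓝 (e p) := by
      apply Metric.isOpen_ball.mem_nhds
      rw [Metric.mem_ball]
      linarith
    have h2 : (Metric.closedBall (e q) (d / 2))ᶜ ∈ 𝓝 (e p) := by
      apply Metric.isClosed_closedBall.isOpen_compl.mem_nhds
      rw [mem_compl_iff, Metric.mem_closedBall, not_le]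
      linarith
    filter_upwards [h1, h2] with y hy1 hy2
    exact ⟨Metric.ball_subset_closedBall hy1, fun h => hy2 (Metric.ball_subset_closedBall h)⟩
  have hDn : e.symm '' T ∈ 𝓝 p := by
    filter_upwards [e.open_source.mem_nhds hp, (e.continuousAt hp).preimage_mem_nhds hTn]
      with w hw hwT
    exact ⟨e w, hwT, e.left_inv hw⟩
  refine ⟨e.symm '' T, hDn, fun N hN => ?_⟩
  have hN' : e.symm ⁻¹' N ∈ 𝓝 (e q) := (e.tendsto_symm hq) hN
  obtain ⟨ε, hε, hεN⟩ := Metric.mem_nhds_iff.1 hN'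
  set r := min ε (d / 2) with hr
  have hr0 : 0 < r := by positivity
  have hrd : r ≤ d / 2 := min_le_right _ _
  obtain ⟨α, hα0, hα1, κ, hκ, hα2⟩ := hA.exists_ball_barrier he hr0
    (show r < R by linarith) hR
  refine ⟨α, hα0, ⟨e.symm '' Metric.closedBall (e q) R,
    (isCompact_closedBall _ _).image_of_continuousOn (e.continuousOn_symm.mono hR), ?_, ?_⟩, ?_, ?_⟩
  · rintro _ ⟨y, hy, rfl⟩
    exact hV y hy
  · intro x hx
    refine le_antisymm (not_lt.1 fun h => hx ?_) (hα0 x)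
    obtain ⟨h1, h2⟩ := (hα1 x).1 h
    exact ⟨e x, Metric.ball_subset_closedBall h2, e.left_inv h1⟩
  · intro x hx
    refine le_trans (mul_nonneg hκ.le (hα0 x)) (hα2 x ?_)
    rintro ⟨h1, h2⟩
    apply hx
    have := hεN (Metric.ball_subset_ball (min_le_left _ _) h2)
    rwa [mem_preimage, e.left_inv h1] at this
  · have hpD := mem_of_mem_nhds hDn
    obtain ⟨x₀, hx₀, hmin⟩ := hDc.exists_isMinOn ⟨p, hpD⟩ α.contMDiff.continuous.continuousOn
    have hpos : 0 < α x₀ := by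
      obtain ⟨y, hy, rfl⟩ := hx₀
      refine (hα1 _).2 ⟨e.map_target (hTt hy), ?_⟩
      rw [e.right_inv (hTt hy)]
      exact hTR hy
    refine ⟨min (α x₀) (κ * α x₀), lt_min hpos (mul_pos hκ hpos), fun x hx => ?_⟩
    have h1 : α x₀ ≤ α x := hmin hx
    refine ⟨(min_le_left _ _).trans h1, (min_le_right _ _).trans (le_trans ?_ (hα2 x ?_))⟩
    · gcongr
    · rintro ⟨h2, h3⟩
      obtain ⟨y, hy, rfl⟩ := hx
      rw [e.right_inv (hTt hy)] at h3
      exact hy.2 (Metric.ball_subset_ball hrd h3)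

/-- The neighborhood `D'` of `q` on which `β` is strict does not depend on the target, so `α` can be
made to fail only in `D'`. The multiple `C / δ'` of `β` then absorbs the loss `-C`. Separating `p`
from `r` keeps the failure of `β` away from `D ∩ O`. -/
lemma IsLocallyUniformlyElliptic.pushable_trans (hA : IsLocallyUniformlyElliptic A) {V : Set M}
    {p q r : M} (h1 : Pushable A V p q) (h2 : Pushable A V q r) : Pushable A V p r := by
  -- `Pushable` is vacuous for equal points: small `N` inside `D` would otherwise demand a compactly
  -- supported subsolution strict near `p`, which the maximum principle excludes when `c = 0`.
  rcases eq_or_ne p q with rfl | hpq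
  · exact h2
  rcases eq_or_ne q r with rfl | hqr
  · exact h1
  intro hpr
  obtain ⟨D, hD, hα⟩ := h1 hpq
  obtain ⟨D', hD', hβ⟩ := h2 hqr
  obtain ⟨O, O', hO, hO', hpO, hrO', hdisj⟩ := t2_separation hpr
  refine ⟨D ∩ O, inter_mem hD (hO.mem_nhds hpO), fun N hN => ?_⟩
  obtain ⟨β, hβ0, ⟨S', hS', hS'V, hβS⟩, hβA, δ', hδ', hβD⟩ :=
    hβ (N ∩ O') (inter_mem hN (hO'.mem_nhds hrO'))
  obtain ⟨α, hα0, ⟨S, hS, hSV, hαS⟩, hαA, δ, hδ, hαD⟩ := hα D' hD'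
  obtain ⟨C, hC0, hC⟩ := hA.exists_lower_bound α hS hαS
  refine ⟨α + (C / δ') • β, fun x => ?_, ⟨S ∪ S', hS.union hS', union_subset hSV hS'V, ?_⟩, ?_,
    δ, hδ, ?_⟩
  · have := hα0 x
    have := hβ0 x
    have : 0 ≤ C / δ' := by positivity
    simp only [ContMDiffMap.coe_add, ContMDiffMap.coe_smul, Pi.add_apply, Pi.smul_apply, smul_eq_mul]
    positivity
  · intro x hx
    simp only [mem_union, not_or] at hx
    simp [hαS x hx.1, hβS x hx.2]
  · intro x hx
    have hb := hβA x fun h => hx h.1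
    have hcd : 0 ≤ C / δ' := by positivity
    simp only [map_add, map_smul, Pi.add_apply, Pi.smul_apply, smul_eq_mul]
    by_cases hxD : x ∈ D'
    · have h3 := hC x
      have h4 : C / δ' * δ' ≤ C / δ' * A β x := by gcongr; exact (hβD x hxD).2
      rw [div_mul_cancel₀ _ hδ'.ne'] at h4
      linarith
    · have := hαA x hxD
      positivity
  · intro x hx
    have hcd : 0 ≤ C / δ' := by positivity
    have h3 := hαD x hx.1
    have h4 := hβA x fun h => hdisj.le_bot ⟨hx.2, h.2⟩
    have h5 := mul_nonneg hcd h4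
    have h6 := mul_nonneg hcd (hβ0 x)
    simp only [map_add, map_smul, Pi.add_apply, Pi.smul_apply, smul_eq_mul,
      ContMDiffMap.coe_add, ContMDiffMap.coe_smul]
    constructor <;> linarith

lemma IsLocallyUniformlyElliptic.eventually_pushable (hA : IsLocallyUniformlyElliptic A)
    {V : Set M} (hV : IsOpen V) {x : M} (hx : x ∈ V) :
    ∀ᶠ y in 𝓝 x, Pushable A V x y ∧ Pushable A V y x := by
  set e := chartAt (EuclideanSpace ℝ (Fin n)) x with he
  have hes := IsManifold.chart_mem_maximalAtlas (I := 𝓡 n) (n := ∞) x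
  have hxs : x ∈ e.source := mem_chart_source _ x
  have hmem : e.target ∩ e.symm ⁻¹' V ∈ 𝓝 (e x) :=
    inter_mem (e.open_target.mem_nhds (e.map_source hxs)) (e.tendsto_symm hxs (hV.mem_nhds hx))
  obtain ⟨ε, hε, hball⟩ := Metric.nhds_basis_closedBall.mem_iff.1 hmem
  have hnear : ∀ᶠ y in 𝓝 x, e y ∈ Metric.ball (e x) (ε / 3) :=
    (e.continuousAt hxs).eventually (Metric.ball_mem_nhds _ (by positivity))
  filter_upwards [hnear, e.open_source.mem_nhds hxs] with y hy hys
  rw [Metric.mem_ball] at hy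
  have hsub : Metric.closedBall (e y) (ε / 2) ⊆ Metric.closedBall (e x) ε :=
    Metric.closedBall_subset_closedBall' (by linarith)
  -- The ball must be centred at the target: radius `ε / 2` about `e y` still contains `e x` and
  -- lies in the good ball about `e x`.
  refine ⟨hA.pushable_of_ball hes hxs hys (R := ε / 2) (by rw [dist_comm]; linarith)
    (fun w hw => (hball (hsub hw)).1) (fun w hw => (hball (hsub hw)).2),
    hA.pushable_of_ball hes hys hxs (R := ε) (by linarith) (fun w hw => (hball hw).1)
    (fun w hw => (hball hw).2)⟩

lemma IsLocallyUniformlyElliptic.pushable (hA : IsLocallyUniformlyElliptic A)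
    {V : Set M} (hV : IsOpen V) (hVc : IsPreconnected V) {p q : M} (hp : p ∈ V) (hq : q ∈ V) :
    Pushable A V p q :=
  hVc.induction₂' (Pushable A V)
    (fun _ hx => (hA.eventually_pushable hV hx).filter_mono nhdsWithin_le_nhds)
    (fun _ _ _ _ _ _ h1 h2 => hA.pushable_trans h1 h2) hp hq

end Manifold

/-! ### Filled compact exhaustions -/

section Filled

variable {X : Type*} [TopologicalSpace X]

/-- No connected component of the complement of `K` is relatively compact. -/
def IsFilled (K : Set X) : Prop :=
  ∀ x ∈ Kᶜ, ¬ IsCompact (closure (connectedComponentIn Kᶜ x))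

/-- The union of `K` and the relatively compact connected components of its complement. -/
def filledHull (K : Set X) : Set X :=
  {x | IsCompact (closure (connectedComponentIn Kᶜ x))}

lemma subset_filledHull (K : Set X) : K ⊆ filledHull K := by
  intro x hx
  rw [filledHull, mem_ofPred_eq, connectedComponentIn_eq_empty (by simpa using hx)]
  simp

lemma connectedComponentIn_subset_compl_filledHull {K : Set X} {x : X} (hx : x ∉ filledHull K) :
    connectedComponentIn Kᶜ x ⊆ (filledHull K)ᶜ := by
  intro y hy h
  rw [filledHull, mem_ofPred_eq, ← connectedComponentIn_eq hy] at h
  exact hx h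

/-- A component of `Kᶜ` that is not relatively compact survives whole in the complement of the hull,
so the component there containing it is not relatively compact either. -/
lemma isFilled_filledHull [R1Space X] (K : Set X) : IsFilled (filledHull K) := by
  intro x hx h
  have hxK : x ∈ Kᶜ := fun h => hx (subset_filledHull K h)
  have hsub : connectedComponentIn Kᶜ x ⊆ connectedComponentIn (filledHull K)ᶜ x :=
    isPreconnected_connectedComponentIn.subset_connectedComponentIn (mem_connectedComponentIn hxK)
      (connectedComponentIn_subset_compl_filledHull hx)
  exact hx (h.of_isClosed_subset isClosed_closure (closure_mono hsub))

lemma isClosed_filledHull [LocallyConnectedSpace X] {K : Set X} (hK : IsClosed K) :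
    IsClosed (filledHull K) := by
  rw [← isOpen_compl_iff, isOpen_iff_mem_nhds]
  intro x hx
  have hxK : x ∈ Kᶜ := fun h => hx (subset_filledHull K h)
  exact mem_of_superset (hK.isOpen_compl.connectedComponentIn.mem_nhds
    (mem_connectedComponentIn hxK)) (connectedComponentIn_subset_compl_filledHull hx)

/-- For a compact neighborhood `L` of `K`, finitely many components of `Kᶜ` cover the frontier of
`interior L`. A component missing this frontier and reaching outside `L` would be clopen, hence
everything, contradicting `K.Nonempty`. So the hull lies in `L` and finitely many compact closures.
-/
lemma isCompact_filledHull [T2Space X] [LocallyCompactSpace X] [LocallyConnectedSpace X]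
    [PreconnectedSpace X] {K : Set X} (hK : IsCompact K) (hne : K.Nonempty) :
    IsCompact (filledHull K) := by
  obtain ⟨L, hL, hKL⟩ := exists_compact_superset hK
  have hF : IsCompact (frontier (interior L)) :=
    hL.of_isClosed_subset isClosed_frontier
      (frontier_subset_closure.trans (closure_minimal interior_subset hL.isClosed))
  have hFK : frontier (interior L) ⊆ Kᶜ := by
    intro x hx hxK
    rw [isOpen_interior.frontier_eq] at hx
    exact hx.2 (hKL hxK)
  obtain ⟨t, htF, ht⟩ := hF.elim_nhds_subcover (fun x => connectedComponentIn Kᶜ x)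
    (fun x hx => hK.isClosed.isOpen_compl.connectedComponentIn.mem_nhds
      (mem_connectedComponentIn (hFK hx)))
  classical
  set t' := t.filter fun x => IsCompact (closure (connectedComponentIn Kᶜ x)) with ht'
  have hB : IsCompact (L ∪ ⋃ x ∈ t', closure (connectedComponentIn Kᶜ x)) := by
    refine hL.union (t'.isCompact_biUnion fun x hx => ?_)
    exact (Finset.mem_filter.1 hx).2
  refine hB.of_isClosed_subset (isClosed_filledHull hK.isClosed) ?_
  intro y hy
  by_cases hyL : y ∈ L
  · exact Or.inl hyL
  right
  have hyK : y ∈ Kᶜ := fun h => hyL (interior_subset (hKL h))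
  by_cases hz : (connectedComponentIn Kᶜ y ∩ frontier (interior L)).Nonempty
  · obtain ⟨w, hw, hwF⟩ := hz
    obtain ⟨x, hxt, hwx⟩ := mem_iUnion₂.1 (ht hwF)
    have e : connectedComponentIn Kᶜ x = connectedComponentIn Kᶜ y :=
      (connectedComponentIn_eq hwx).trans (connectedComponentIn_eq hw).symm
    refine mem_iUnion₂.2 ⟨x, Finset.mem_filter.2 ⟨hxt, ?_⟩, ?_⟩
    · rw [e]
      exact hy
    · rw [e]
      exact subset_closure (mem_connectedComponentIn hyK)
  · exfalso
    have hout : connectedComponentIn Kᶜ y ⊆ (closure (interior L))ᶜ := by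
      have hcover : connectedComponentIn Kᶜ y ⊆ interior L ∪ (closure (interior L))ᶜ := by
        intro w hw
        by_contra h
        simp only [mem_union, mem_compl_iff, not_or, not_not] at h
        refine hz ⟨w, hw, ?_⟩
        rw [isOpen_interior.frontier_eq]
        exact ⟨h.2, h.1⟩
      have hyc : y ∈ (closure (interior L))ᶜ := fun h =>
        hyL (closure_minimal interior_subset hL.isClosed h)
      refine isPreconnected_connectedComponentIn.subset_right_of_subset_union isOpen_interior
        isClosed_closure.isOpen_compl ?_ hcover ⟨y, mem_connectedComponentIn hyK, hyc⟩
      exact disjoint_compl_right.mono_left subset_closure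
    have hcl : closure (connectedComponentIn Kᶜ y) ⊆ Kᶜ := by
      have : closure (connectedComponentIn Kᶜ y) ⊆ (interior L)ᶜ :=
        closure_minimal (fun w hw h => hout hw (subset_closure h))
          isOpen_interior.isClosed_compl
      exact this.trans (compl_subset_compl.2 hKL)
    have hclosed : IsClosed (connectedComponentIn Kᶜ y) := by
      refine isClosed_of_closure_subset ?_
      exact isPreconnected_connectedComponentIn.closure.subset_connectedComponentIn
        (subset_closure (mem_connectedComponentIn hyK)) hcl
    have huniv := IsClopen.eq_univ ⟨hclosed, hK.isClosed.isOpen_compl.connectedComponentIn⟩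
      ⟨y, mem_connectedComponentIn hyK⟩
    obtain ⟨k, hk⟩ := hne
    have : k ∈ connectedComponentIn Kᶜ y := huniv ▸ mem_univ k
    exact connectedComponentIn_subset _ _ this hk

lemma IsFilled.exists_exhaustion [T2Space X] [LocallyCompactSpace X] [SigmaCompactSpace X]
    [LocallyConnectedSpace X] [ConnectedSpace X] {K : Set X} (hK : IsCompact K)
    (hKf : IsFilled K) :
    ∃ κ : ℕ → Set X, κ 0 = K ∧ (∀ j, IsCompact (κ j)) ∧ (∀ j, IsFilled (κ j)) ∧
      (∀ j, κ j ⊆ interior (κ (j + 1))) ∧ ∀ x, ∃ j, x ∈ κ j := by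
  obtain ⟨x₀⟩ : Nonempty X := inferInstance
  have step : ∀ (j : ℕ) (L : {L : Set X // IsCompact L ∧ IsFilled L}),
      ∃ L' : {L : Set X // IsCompact L ∧ IsFilled L},
        (L : Set X) ∪ compactCovering X j ⊆ interior (L' : Set X) := by
    rintro j ⟨L, hL, -⟩
    -- The point `x₀` makes `T` nonempty even when `K` is empty.
    obtain ⟨T, hT, hsub⟩ := exists_compact_superset
      ((hL.union (isCompact_compactCovering X j)).union (isCompact_singleton (x := x₀)))
    have hne : T.Nonempty := ⟨x₀, interior_subset (hsub (Or.inr rfl))⟩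
    exact ⟨⟨filledHull T, isCompact_filledHull hT hne, isFilled_filledHull T⟩,
      (subset_union_left.trans hsub).trans (interior_mono (subset_filledHull T))⟩
  choose next hnext using step
  let κ : ℕ → {L : Set X // IsCompact L ∧ IsFilled L} := fun j =>
    Nat.rec (motive := fun _ => {L : Set X // IsCompact L ∧ IsFilled L}) ⟨K, hK, hKf⟩ next j
  have hs : ∀ j, (κ j).1 ∪ compactCovering X j ⊆ interior (κ (j + 1)).1 :=
    fun j => hnext j (κ j)
  refine ⟨fun j => (κ j).1, rfl, fun j => (κ j).2.1, fun j => (κ j).2.2,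
    fun j => subset_union_left.trans (hs j), fun x => ?_⟩
  obtain ⟨j, hj⟩ : ∃ j, x ∈ compactCovering X j := by
    have : x ∈ ⋃ j, compactCovering X j := iUnion_compactCovering X ▸ mem_univ x
    simpa using this
  exact ⟨j + 1, interior_subset (hs j (Or.inr hj))⟩

end Filled

/-! ### Compensated and locally finite sums -/

/-- If every negative term is compensated by its successor, partial sums are bounded below by
the negative part of the last term. -/
lemma min_zero_le_sum_of_compensated {g : ℕ → ℝ} (h : ∀ j, g j < 0 → 0 ≤ g j + g (j + 1)) (k : ℕ) :
    min 0 (g k) ≤ ∑ j ∈ Finset.range (k + 1), g j := by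
  induction k with
  | zero => simp
  | succ k ih =>
    rw [Finset.sum_range_succ]
    rcases min_le_iff.1 ih with h0 | h1
    · exact (min_le_right _ _).trans (by linarith)
    · rcases lt_or_ge (g k) 0 with hk | hk
      · exact (min_le_left _ _).trans (by linarith [h k hk])
      · exact (min_le_right _ _).trans (by linarith)

section Manifold

variable {n : ℕ} {M : Type*} [TopologicalSpace M] [ChartedSpace (EuclideanSpace ℝ (Fin n)) M]

lemma coe_finset_sum (f : ℕ → C^∞⟮𝓡 n, M; ℝ⟯) (s : Finset ℕ) (x : M) :
    (∑ j ∈ s, f j) x = ∑ j ∈ s, f j x := by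
  induction s using Finset.cons_induction with
  | empty => simp
  | cons a s ha ih => rw [Finset.sum_cons, Finset.sum_cons, ← ih]; rfl

/-- Locally finite sums of smooth functions are smooth and commute with the operator. -/
lemma IsLocallyUniformlyElliptic.exists_locallyFinite_sum [IsManifold (𝓡 n) ∞ M]
    {A : C^∞⟮𝓡 n, M; ℝ⟯ →ₗ[ℝ] (M → ℝ)}
    (hA : IsLocallyUniformlyElliptic A) (f : ℕ → C^∞⟮𝓡 n, M; ℝ⟯)
    (hf : ∀ x, ∃ k, ∀ᶠ y in 𝓝 x, ∀ j ≥ k, f j y = 0) :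
    ∃ F : C^∞⟮𝓡 n, M; ℝ⟯, ∀ x, ∃ k, ∀ m ≥ k, F x = ∑ j ∈ Finset.range m, f j x ∧
      A F x = ∑ j ∈ Finset.range m, A (f j) x ∧ f m x = 0 ∧ A (f m) x = 0 := by
  choose k hk using hf
  have hloc : ∀ x, ∀ m ≥ k x, ∀ᶠ y in 𝓝 x,
      (∑' j, f j y) = (∑ j ∈ Finset.range m, f j : C^∞⟮𝓡 n, M; ℝ⟯) y := by
    intro x m hm
    filter_upwards [hk x] with y hy
    rw [coe_finset_sum]
    refine tsum_eq_sum fun j hj => hy j (hm.trans ?_)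
    simpa using hj
  have hsm : ContMDiff (𝓡 n) 𝓘(ℝ, ℝ) ∞ (fun y => ∑' j, f j y) := fun x =>
    (ContMDiffMap.contMDiff (∑ j ∈ Finset.range (k x), f j)).contMDiffAt.congr_of_eventuallyEq
      (hloc x _ le_rfl)
  set F : C^∞⟮𝓡 n, M; ℝ⟯ := ⟨fun y => ∑' j, f j y, hsm⟩ with hF
  refine ⟨F, fun x => ⟨k x, fun m hm => ⟨?_, ?_, ?_, ?_⟩⟩⟩
  · rw [← coe_finset_sum]
    exact (hloc x m hm).self_of_nhds
  · rw [hA.apply_congr (f := F) (g := ∑ j ∈ Finset.range m, f j) (hloc x m hm), map_sum, Finset.sum_apply]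
  · exact (hk x).self_of_nhds m hm
  · exact hA.apply_eq_zero ((hk x).mono fun y hy => hy m hm)

end Manifold

/-! ### Pushing the failure to infinity -/

section Manifold

variable {n : ℕ} {M : Type*} [TopologicalSpace M] [T2Space M] [LocallyConnectedSpace M]
  [ChartedSpace (EuclideanSpace ℝ (Fin n)) M] [IsManifold (𝓡 n) ∞ M]
  {A : C^∞⟮𝓡 n, M; ℝ⟯ →ₗ[ℝ] (M → ℝ)}

/-- From a point outside the first set of a filled exhaustion, there is a sequence of points
escaping to infinity whose consecutive members are joined outside the sets of the exhaustion. -/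
lemma exists_escaping_sequence {X : Type*} [TopologicalSpace X] [T2Space X] {κ : ℕ → Set X}
    (hc : ∀ j, IsCompact (κ j)) (hf : ∀ j, IsFilled (κ j)) {p : X} (hp : p ∉ κ 0) :
    ∃ q : ℕ → X, q 0 = p ∧ ∀ j, q j ∉ κ j ∧ q j ≠ q (j + 1) ∧
      q (j + 1) ∈ connectedComponentIn (κ j)ᶜ (q j) := by
  have step : ∀ (j : ℕ) (q : X), ∃ q', q ∉ κ j →
      q' ∉ κ (j + 1) ∧ q ≠ q' ∧ q' ∈ connectedComponentIn (κ j)ᶜ q := by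
    intro j q
    by_cases hq : q ∈ κ j
    · exact ⟨q, fun h => absurd hq h⟩
    -- Otherwise the component would have compact closure. Excluding `q` as well makes consecutive
    -- points distinct, as `Pushable` requires.
    have h : ¬ connectedComponentIn (κ j)ᶜ q ⊆ κ (j + 1) ∪ {q} := by
      intro h
      have hcpt := (hc (j + 1)).union (isCompact_singleton (x := q))
      exact hf j q hq (hcpt.of_isClosed_subset isClosed_closure (closure_minimal h hcpt.isClosed))
    obtain ⟨q', hq', hn⟩ := not_subset.1 h
    simp only [mem_union, mem_singleton_iff, not_or] at hn
    exact ⟨q', fun _ => ⟨hn.1, fun h => hn.2 h.symm, hq'⟩⟩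
  choose next hnext using step
  let q : ℕ → X := fun j => Nat.rec (motive := fun _ => X) p next j
  have hq : ∀ j, q j ∉ κ j := by
    intro j
    induction j with
    | zero => exact hp
    | succ j ih => exact (hnext j (q j) ih).1
  exact ⟨q, rfl, fun j => ⟨hq j, (hnext j (q j) (hq j)).2⟩⟩

/-- Near a point outside a filled exhaustion there are global nonnegative subsolutions, vanishing
on the first set of the exhaustion, which are strict subsolutions near the point. -/
lemma IsLocallyUniformlyElliptic.exists_subsolution (hA : IsLocallyUniformlyElliptic A)
    {κ : ℕ → Set M} (hc : ∀ j, IsCompact (κ j)) (hf : ∀ j, IsFilled (κ j))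
    (hκ : ∀ j, κ j ⊆ interior (κ (j + 1))) (hcov : ∀ x, ∃ j, x ∈ κ j) {p : M} (hp : p ∉ κ 0) :
    ∃ φ : C^∞⟮𝓡 n, M; ℝ⟯, (∀ x, 0 ≤ φ x) ∧ (∀ x, 0 ≤ A φ x) ∧ (∀ x ∈ κ 0, φ x = 0) ∧
      ∃ U ∈ 𝓝 p, ∃ δ > 0, ∀ x ∈ U, δ ≤ φ x ∧ δ ≤ A φ x := by
  have hmono : Monotone κ := monotone_nat_of_le_succ fun j => (hκ j).trans interior_subset
  obtain ⟨q, rfl, hq⟩ := exists_escaping_sequence hc hf hp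
  have hpush : ∀ j, Pushable A (connectedComponentIn (κ j)ᶜ (q j)) (q j) (q (j + 1)) := fun j =>
    hA.pushable (hc j).isClosed.isOpen_compl.connectedComponentIn
      isPreconnected_connectedComponentIn (mem_connectedComponentIn (hq j).1) (hq j).2.2
  choose D hD hpush' using fun j => hpush j (hq j).2.1
  -- The failure of `α j` is placed in `D (j + 1)`, exactly where `α (j + 1)` is strict.
  choose α hα0 hαS hαA δ hδ hαD using fun j => hpush' j (D (j + 1)) (hD (j + 1))
  choose S hS hSV hSα using hαS
  choose C hC0 hC using fun j => hA.exists_lower_bound (α j) (hS j) (hSα j)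
  have hα_zero : ∀ j, ∀ x ∈ κ j, α j x = 0 := fun j x hx =>
    hSα j x fun h => connectedComponentIn_subset _ _ (hSV j h) hx
  -- The recursion `c (j + 1) * δ (j + 1) = c j * C j` makes each gain cancel the worst loss of the
  -- previous term. A zero weight is harmless.
  let c : ℕ → ℝ := fun j =>
    Nat.rec (motive := fun _ => ℝ) 1 (fun j c => c * C j / δ (j + 1)) j
  have hc_succ : ∀ j, c (j + 1) * δ (j + 1) = c j * C j := fun j =>
    div_mul_cancel₀ _ (hδ (j + 1)).ne'
  have hc0 : ∀ j, 0 ≤ c j := by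
    intro j
    induction j with
    | zero => exact zero_le_one
    | succ j ih => exact div_nonneg (mul_nonneg ih (hC0 j)) (hδ (j + 1)).le
  obtain ⟨F, hF⟩ := hA.exists_locallyFinite_sum (fun j => c j • α j) (by
    intro x
    obtain ⟨k, hk⟩ := hcov x
    refine ⟨k + 1, ?_⟩
    filter_upwards [isOpen_interior.mem_nhds (hκ k hk)] with y hy j hj
    simp [hα_zero j y (hmono hj (interior_subset hy))])
  have hcomp : ∀ x j, A (c j • α j) x < 0 → 0 ≤ A (c j • α j) x + A (c (j + 1) • α (j + 1)) x := by
    intro x j hj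
    simp only [map_smul, Pi.smul_apply, smul_eq_mul] at hj ⊢
    have hx : x ∈ D (j + 1) := by
      by_contra hx
      exact absurd (mul_nonneg (hc0 j) (hαA j x hx)) (not_le.2 hj)
    have h1 : c (j + 1) * δ (j + 1) ≤ c (j + 1) * A (α (j + 1)) x :=
      mul_le_mul_of_nonneg_left (hαD (j + 1) x hx).2 (hc0 (j + 1))
    have h2 : c j * -C j ≤ c j * A (α j) x := mul_le_mul_of_nonneg_left (hC j x) (hc0 j)
    rw [hc_succ] at h1
    linarith
  have hterm : ∀ x j, 0 ≤ (c j • α j : C^∞⟮𝓡 n, M; ℝ⟯) x := fun x j => by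
    simpa using mul_nonneg (hc0 j) (hα0 j x)
  refine ⟨F, fun x => ?_, fun x => ?_, fun x hx => ?_, D 0, hD 0, δ 0, hδ 0, fun x hx => ⟨?_, ?_⟩⟩
  · obtain ⟨k, hk⟩ := hF x
    rw [(hk k le_rfl).1]
    exact Finset.sum_nonneg fun j _ => hterm x j
  · obtain ⟨k, hk⟩ := hF x
    rw [(hk (k + 1) (by omega)).2.1]
    -- The term of index `k` vanishes at `x`, so no uncompensated loss remains.
    have := min_zero_le_sum_of_compensated (hcomp x) k
    rwa [(hk k le_rfl).2.2.2, min_self] at this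
  · obtain ⟨k, hk⟩ := hF x
    rw [(hk k le_rfl).1]
    refine Finset.sum_eq_zero fun j _ => ?_
    simp [hα_zero j x (hmono (Nat.zero_le j) hx)]
  · obtain ⟨k, hk⟩ := hF x
    rw [(hk (k + 1) (by omega)).1]
    have h1 := Finset.single_le_sum (f := fun j => (c j • α j : C^∞⟮𝓡 n, M; ℝ⟯) x)
      (fun j _ => hterm x j) (Finset.mem_range.2 (Nat.succ_pos k))
    have h2 : (c 0 • α 0 : C^∞⟮𝓡 n, M; ℝ⟯) x = α 0 x := by simp [c]
    exact ((hαD 0 x hx).1.trans_eq h2.symm).trans h1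
  · obtain ⟨k, hk⟩ := hF x
    -- Compensation is applied to the terms of index at least one, leaving the full gain `δ 0` of
    -- the first term on `D 0`.
    rw [(hk (k + 1 + 1) (by omega)).2.1, Finset.sum_range_succ']
    have h1 := min_zero_le_sum_of_compensated (g := fun j => A (c (j + 1) • α (j + 1)) x)
      (fun j => hcomp x (j + 1)) k
    simp only [(hk (k + 1) (by omega)).2.2.2, min_self] at h1
    have h2 : A (c 0 • α 0) x = A (α 0) x := by simp [c]
    have h3 := (hαD 0 x hx).2
    linarith

/-- A compact set outside the first set of a filled exhaustion carries a global nonnegative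
subsolution, vanishing on that first set, which is large and strict on the compact set. -/
lemma IsLocallyUniformlyElliptic.exists_large_subsolution (hA : IsLocallyUniformlyElliptic A)
    {κ : ℕ → Set M} (hc : ∀ j, IsCompact (κ j)) (hf : ∀ j, IsFilled (κ j))
    (hκ : ∀ j, κ j ⊆ interior (κ (j + 1))) (hcov : ∀ x, ∃ j, x ∈ κ j) {E : Set M}
    (hE : IsCompact E) (hE0 : ∀ x ∈ E, x ∉ κ 0) (B : ℝ) :
    ∃ φ : C^∞⟮𝓡 n, M; ℝ⟯, (∀ x, 0 ≤ φ x) ∧ (∀ x, 0 ≤ A φ x) ∧ (∀ x ∈ κ 0, φ x = 0) ∧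
      ∀ x ∈ E, B ≤ φ x ∧ B ≤ A φ x := by
  have key : ∃ φ : C^∞⟮𝓡 n, M; ℝ⟯, (∀ x, 0 ≤ φ x) ∧ (∀ x, 0 ≤ A φ x) ∧ (∀ x ∈ κ 0, φ x = 0) ∧
      ∃ δ > 0, ∀ x ∈ E, δ ≤ φ x ∧ δ ≤ A φ x := by
    refine hE.induction_on (p := fun E => ∃ φ : C^∞⟮𝓡 n, M; ℝ⟯, (∀ x, 0 ≤ φ x) ∧
      (∀ x, 0 ≤ A φ x) ∧ (∀ x ∈ κ 0, φ x = 0) ∧ ∃ δ > 0, ∀ x ∈ E, δ ≤ φ x ∧ δ ≤ A φ x)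
      ⟨0, by simp, by simp, by simp, 1, one_pos, by simp⟩ ?_ ?_ ?_
    · rintro S T hST ⟨φ, h1, h2, h3, δ, hδ, h4⟩
      exact ⟨φ, h1, h2, h3, δ, hδ, fun x hx => h4 x (hST hx)⟩
    · rintro S T ⟨φ, h1, h2, h3, δ, hδ, h4⟩ ⟨φ', h1', h2', h3', δ', hδ', h4'⟩
      refine ⟨φ + φ', fun x => ?_, fun x => ?_, fun x hx => ?_, min δ δ', lt_min hδ hδ', ?_⟩
      · simpa using add_nonneg (h1 x) (h1' x)
      · simpa using add_nonneg (h2 x) (h2' x)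
      · simp [h3 x hx, h3' x hx]
      · rintro x (hx | hx)
        · have := h4 x hx
          have := h1' x
          have := h2' x
          have := min_le_left δ δ'
          simp only [ContMDiffMap.coe_add, Pi.add_apply, map_add]
          constructor <;> linarith
        · have := h4' x hx
          have := h1 x
          have := h2 x
          have := min_le_right δ δ'
          simp only [ContMDiffMap.coe_add, Pi.add_apply, map_add]
          constructor <;> linarith
    · intro p hp
      obtain ⟨φ, h1, h2, h3, U, hU, δ, hδ, h4⟩ := hA.exists_subsolution hc hf hκ hcov (hE0 p hp)
      exact ⟨U, mem_nhdsWithin_of_mem_nhds hU, φ, h1, h2, h3, δ, hδ, h4⟩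
  obtain ⟨φ, h1, h2, h3, δ, hδ, h4⟩ := key
  have hB : 0 ≤ |B| / δ := by positivity
  have hBδ : B ≤ |B| / δ * δ := by
    rw [div_mul_cancel₀ _ hδ.ne']
    exact le_abs_self B
  refine ⟨(|B| / δ) • φ, fun x => ?_, fun x => ?_, fun x hx => ?_, fun x hx => ?_⟩
  · simpa using mul_nonneg hB (h1 x)
  · simpa using mul_nonneg hB (h2 x)
  · simp [h3 x hx]
  · simp only [ContMDiffMap.coe_smul, Pi.smul_apply, map_smul, smul_eq_mul]
    exact ⟨hBδ.trans (mul_le_mul_of_nonneg_left (h4 x hx).1 hB),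
      hBδ.trans (mul_le_mul_of_nonneg_left (h4 x hx).2 hB)⟩

end Manifold

/-! ### Convergent series of smooth functions -/

/-- All derivatives of the terms are bounded uniformly by summable sequences. -/
def SmoothlySummable {n : ℕ} (h : ℕ → EuclideanSpace ℝ (Fin n) → ℝ) : Prop :=
  (∀ k, ContDiff ℝ ∞ (h k)) ∧ ∃ v : ℕ → ℕ → ℝ, (∀ m, Summable (v m)) ∧
    ∀ m k y, ‖iteratedFDeriv ℝ m (h k) y‖ ≤ v m k

namespace SmoothlySummable

variable {n : ℕ} {h : ℕ → EuclideanSpace ℝ (Fin n) → ℝ}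

lemma hasSum (hh : SmoothlySummable h) (y : EuclideanSpace ℝ (Fin n)) :
    HasSum (fun k => h k y) (∑' k, h k y) := by
  obtain ⟨-, v, hv, hb⟩ := hh
  refine Summable.hasSum (Summable.of_norm_bounded (hv 0) fun k => ?_)
  simpa using hb 0 k y

lemma contDiff_tsum (hh : SmoothlySummable h) : ContDiff ℝ ∞ fun y => ∑' k, h k y := by
  obtain ⟨hc, v, hv, hb⟩ := hh
  exact _root_.contDiff_tsum (N := ⊤) hc (fun m _ => hv m) (fun m k y _ => hb m k y)

lemma partialDeriv (hh : SmoothlySummable h) (i : Fin n) :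
    SmoothlySummable fun k => partialDeriv i (h k) := by
  obtain ⟨hc, v, hv, hb⟩ := hh
  have hfd : ∀ k, ContDiff ℝ ∞ (fderiv ℝ (h k)) := fun k =>
    (hc k).fderiv_right (by simp)
  refine ⟨fun k => (hfd k).clm_apply contDiff_const, fun m => v (m + 1), fun m => hv _, ?_⟩
  intro m k y
  set L : (EuclideanSpace ℝ (Fin n) →L[ℝ] ℝ) →L[ℝ] ℝ :=
    ContinuousLinearMap.apply ℝ ℝ (EuclideanSpace.single i (1 : ℝ)) with hL
  have hL1 : ‖L‖ ≤ 1 := by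
    refine L.opNorm_le_bound zero_le_one fun T => ?_
    have := T.le_opNorm (EuclideanSpace.single i (1 : ℝ))
    simpa [hL] using this
  have h1 := L.norm_iteratedFDeriv_comp_left (N := ∞) (n := m) (hfd k).contDiffAt (x := y)
    (by exact_mod_cast le_top)
  rw [norm_iteratedFDeriv_fderiv] at h1
  refine (h1.trans (mul_le_of_le_one_left (norm_nonneg _) hL1)).trans (hb _ _ _)

lemma partialDeriv_tsum (hh : SmoothlySummable h) (i : Fin n) :
    _root_.partialDeriv i (fun y => ∑' k, h k y) = fun y => ∑' k, _root_.partialDeriv i (h k) y := by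
  have hh' := hh
  obtain ⟨hc, v, hv, hb⟩ := hh
  ext y
  have hfb : ∀ k x, ‖fderiv ℝ (h k) x‖ ≤ v 1 k := fun k x => by
    have := hb 1 k x
    rwa [← norm_iteratedFDeriv_fderiv, norm_iteratedFDeriv_zero] at this
  have h1 := fderiv_tsum_apply (𝕜 := ℝ) (hv 1) (fun k => (hc k).differentiable (by simp)) hfb
    (hh'.hasSum y).summable y
  have hs : Summable fun k => fderiv ℝ (h k) y := Summable.of_norm_bounded (hv 1) fun k => hfb k y
  rw [_root_.partialDeriv, h1]
  exact (ContinuousLinearMap.apply ℝ ℝ (EuclideanSpace.single i (1 : ℝ))).map_tsum hs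

/-- At a fixed `y` the coefficients are mere constants, so no regularity of them is needed to
differentiate termwise. -/
lemma hasSum_secondOrderExpr (hh : SmoothlySummable h)
    (a : EuclideanSpace ℝ (Fin n) → Matrix (Fin n) (Fin n) ℝ)
    (b : EuclideanSpace ℝ (Fin n) → Fin n → ℝ) (c : EuclideanSpace ℝ (Fin n) → ℝ)
    (y : EuclideanSpace ℝ (Fin n)) :
    HasSum (fun k => secondOrderExpr a b c (h k) y)
      (secondOrderExpr a b c (fun y => ∑' k, h k y) y) := by
  have h1 : ∀ i, HasSum (fun k => _root_.partialDeriv i (h k) y)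
      (_root_.partialDeriv i (fun y => ∑' k, h k y) y) := fun i => by
    rw [hh.partialDeriv_tsum i]
    exact (hh.partialDeriv i).hasSum y
  have h2 : ∀ i j, HasSum (fun k => _root_.partialDeriv i (_root_.partialDeriv j (h k)) y)
      (_root_.partialDeriv i (_root_.partialDeriv j (fun y => ∑' k, h k y)) y) := fun i j => by
    rw [hh.partialDeriv_tsum j, (hh.partialDeriv j).partialDeriv_tsum i]
    exact ((hh.partialDeriv j).partialDeriv i).hasSum y
  exact ((hasSum_sum fun i _ => hasSum_sum fun j _ => (h2 i j).mul_left _).add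
    (hasSum_sum fun i _ => (h1 i).mul_left _)).add ((hh.hasSum y).mul_left _)

end SmoothlySummable

section Manifold

variable {n : ℕ} {M : Type*} [TopologicalSpace M]
  [ChartedSpace (EuclideanSpace ℝ (Fin n)) M] [IsManifold (𝓡 n) ∞ M]

/-- One cutoff serves all `f`: the product is smooth with compact support on the whole Euclidean
space, so each of its derivatives is globally bounded, as `SmoothlySummable` demands. -/
lemma exists_chart_cutoff (x : M) :
    ∃ χ : EuclideanSpace ℝ (Fin n) → ℝ, HasCompactSupport χ ∧
      (∀ f : C^∞⟮𝓡 n, M; ℝ⟯, ContDiff ℝ ∞ fun y =>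
        χ y * f ((chartAt (EuclideanSpace ℝ (Fin n)) x).symm y)) ∧
      ∀ᶠ y in 𝓝 (chartAt (EuclideanSpace ℝ (Fin n)) x x), χ y = 1 := by
  set e := chartAt (EuclideanSpace ℝ (Fin n)) x with he
  have hxs : x ∈ e.source := mem_chart_source _ x
  obtain ⟨R, hR, hball⟩ := Metric.nhds_basis_closedBall.mem_iff.1
    (e.open_target.mem_nhds (e.map_source hxs))
  let χ : ContDiffBump (e x) := ⟨R / 2, R, by positivity, by linarith⟩
  refine ⟨χ, χ.hasCompactSupport, fun f => ?_, χ.eventuallyEq_one⟩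
  rw [contDiff_iff_contDiffAt]
  intro y
  by_cases hy : y ∈ e.target
  · exact χ.contDiff.contDiffAt.mul
      ((contDiffOn_comp_symm (IsManifold.chart_mem_maximalAtlas x) f).contDiffAt
        (e.open_target.mem_nhds hy))
  · refine (contDiffAt_const (c := (0 : ℝ))).congr_of_eventuallyEq ?_
    have hyt : y ∉ tsupport χ := by
      rw [χ.tsupport_eq]
      exact fun h => hy (hball h)
    filter_upwards [(isClosed_tsupport _).isOpen_compl.mem_nhds hyt] with w hw
    rw [image_eq_zero_of_notMem_tsupport hw, zero_mul]

/-- Any sequence of smooth functions becomes summable, together with all derivatives, after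
multiplication by suitable positive constants, and the operator commutes with the sum. -/
lemma IsLocallyUniformlyElliptic.exists_convergent_sum [SecondCountableTopology M] [Nonempty M]
    {A : C^∞⟮𝓡 n, M; ℝ⟯ →ₗ[ℝ] (M → ℝ)} (hA : IsLocallyUniformlyElliptic A)
    (f : ℕ → C^∞⟮𝓡 n, M; ℝ⟯) :
    ∃ ε : ℕ → ℝ, (∀ k, 0 < ε k) ∧ ∃ F : C^∞⟮𝓡 n, M; ℝ⟯, ∀ x,
      HasSum (fun k => ε k * f k x) (F x) ∧ HasSum (fun k => ε k * A (f k) x) (A F x) := by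
  choose χ hχc hχs hχ1 using fun x : M => exists_chart_cutoff (n := n) x
  set U : M → Set M := fun x => {w | w ∈ (chartAt (EuclideanSpace ℝ (Fin n)) x).source ∧
    ∀ᶠ y in 𝓝 (chartAt (EuclideanSpace ℝ (Fin n)) x w), χ x y = 1} with hU
  have hUn : ∀ x, U x ∈ 𝓝 x := by
    intro x
    have h1 := (eventually_eventually_nhds.2 (hχ1 x))
    filter_upwards [((chartAt (EuclideanSpace ℝ (Fin n)) x).continuousAt
      (mem_chart_source _ x)).eventually h1, (chartAt (EuclideanSpace ℝ (Fin n)) x).open_source.mem_nhds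
      (mem_chart_source _ x)] with w hw hws
    exact ⟨hws, hw⟩
  obtain ⟨s, hs, hcov⟩ := TopologicalSpace.countable_cover_nhds hUn
  have hsne : s.Nonempty := by
    obtain ⟨x⟩ := ‹Nonempty M›
    have : x ∈ ⋃ x ∈ s, U x := hcov ▸ mem_univ x
    obtain ⟨y, hy, -⟩ := mem_iUnion₂.1 this
    exact ⟨y, hy⟩
  obtain ⟨c, rfl⟩ := hs.exists_eq_range hsne
  set G : ℕ → ℕ → EuclideanSpace ℝ (Fin n) → ℝ := fun i k y =>
    χ (c i) y * f k ((chartAt (EuclideanSpace ℝ (Fin n)) (c i)).symm y) with hG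
  have hGs : ∀ i k, ContDiff ℝ ∞ (G i k) := fun i k => hχs (c i) (f k)
  have hGb : ∀ i k m, ∃ C, ∀ y, ‖iteratedFDeriv ℝ m (G i k) y‖ ≤ C := fun i k m =>
    (((hχc (c i)).mul_right).iteratedFDeriv (𝕜 := ℝ) m).exists_bound_of_continuous
      ((hGs i k).continuous_iteratedFDeriv (by exact_mod_cast le_top))
  choose C hC using hGb
  have hC0 : ∀ i k m, 0 ≤ C i k m := fun i k m => (norm_nonneg _).trans (hC i k m 0)
  -- Diagonal choice: the weight `ε k` controls charts and derivative orders up to `k`, so each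
  -- fixed pair `i`, `m` is controlled for all but finitely many `k`.
  set T : ℕ → ℝ := fun k => ∑ i ∈ Finset.range (k + 1), ∑ m ∈ Finset.range (k + 1), C i k m with hT
  have hT0 : ∀ k, 0 ≤ T k := fun k => Finset.sum_nonneg fun _ _ => Finset.sum_nonneg fun _ _ =>
    hC0 _ _ _
  set ε : ℕ → ℝ := fun k => (1 / 2) ^ k / (1 + T k) with hε
  have hε0 : ∀ k, 0 < ε k := fun k => div_pos (by positivity) (by linarith [hT0 k])
  have hεC : ∀ i m k, i ≤ k → m ≤ k → ε k * C i k m ≤ (1 / 2) ^ k := by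
    intro i m k hi hm
    have h1 : C i k m ≤ T k :=
      (Finset.single_le_sum (f := fun m => C i k m) (fun _ _ => hC0 _ _ _)
        (Finset.mem_range.2 (Nat.lt_succ_of_le hm))).trans
      (Finset.single_le_sum (f := fun i => ∑ m ∈ Finset.range (k + 1), C i k m)
        (fun _ _ => Finset.sum_nonneg fun _ _ => hC0 _ _ _)
        (Finset.mem_range.2 (Nat.lt_succ_of_le hi)))
    rw [hε, div_mul_eq_mul_div, div_le_iff₀ (by linarith [hT0 k])]
    gcongr
    linarith
  have hSS : ∀ i, SmoothlySummable fun k => ε k • G i k := by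
    intro i
    refine ⟨fun k => (hGs i k).const_smul (ε k), fun m k => ε k * C i k m, fun m => ?_,
      fun m k y => ?_⟩
    · refine Summable.of_norm_bounded_eventually_nat (g := fun k => (1 / 2 : ℝ) ^ k)
        (summable_geometric_of_lt_one (by norm_num) (by norm_num)) ?_
      filter_upwards [eventually_ge_atTop (max i m)] with k hk
      rw [Real.norm_of_nonneg (mul_nonneg (hε0 k).le (hC0 _ _ _))]
      exact hεC i m k ((le_max_left _ _).trans hk) ((le_max_right _ _).trans hk)
    · rw [iteratedFDeriv_const_smul_apply ((hGs i k).of_le (by exact_mod_cast le_top)).contDiffAt,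
        norm_smul, Real.norm_of_nonneg (hε0 k).le]
      exact mul_le_mul_of_nonneg_left (hC i k m y) (hε0 k).le
  have hcov' : ∀ x, ∃ i, x ∈ U (c i) := by
    intro x
    have : x ∈ ⋃ y ∈ range c, U y := hcov ▸ mem_univ x
    simpa using this
  have hloc : ∀ (i : ℕ) (x : M), x ∈ U (c i) →
      (fun y => ∑' k, ε k * f k ((chartAt (EuclideanSpace ℝ (Fin n)) (c i)).symm y)) =ᶠ[
        𝓝 (chartAt (EuclideanSpace ℝ (Fin n)) (c i) x)] fun y => ∑' k, (ε k • G i k) y := by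
    rintro i x ⟨-, hx⟩
    filter_upwards [hx] with y hy
    simp [hG, hy]
  have hsm : ContMDiff (𝓡 n) 𝓘(ℝ, ℝ) ∞ fun x => ∑' k, ε k * f k x := by
    intro x
    obtain ⟨i, hx⟩ := hcov' x
    set e := chartAt (EuclideanSpace ℝ (Fin n)) (c i) with he
    have h1 : ContMDiffAt (𝓡 n) 𝓘(ℝ, ℝ) ∞ (fun w => ∑' k, (ε k • G i k) (e w)) x :=
      (hSS i).contDiff_tsum.contMDiff.contMDiffAt.comp x
        (contMDiffAt_of_mem_maximalAtlas (IsManifold.chart_mem_maximalAtlas (c i)) hx.1)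
    refine h1.congr_of_eventuallyEq ?_
    filter_upwards [e.open_source.mem_nhds hx.1, (e.continuousAt hx.1).eventually (hloc i x hx)]
      with w hws hw
    rw [← hw, e.left_inv hws]
  set F : C^∞⟮𝓡 n, M; ℝ⟯ := ⟨fun x => ∑' k, ε k * f k x, hsm⟩ with hF
  refine ⟨ε, hε0, F, fun x => ?_⟩
  obtain ⟨i, hx⟩ := hcov' x
  set e := chartAt (EuclideanSpace ℝ (Fin n)) (c i) with he
  have hGx : ∀ k, (fun y => (ε k • f k) (e.symm y)) =ᶠ[𝓝 (e x)] ε k • G i k := by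
    intro k
    filter_upwards [hx.2] with y hy
    simp only [hG, Pi.smul_apply, hy, one_mul, ContMDiffMap.coe_smul]
    rfl
  constructor
  · have h1 := (hSS i).hasSum (e x)
    have h2 : ∀ k, (ε k • G i k) (e x) = ε k * f k x := by
      intro k
      rw [← (hGx k).self_of_nhds]
      change (ε k • f k) (e.symm (e x)) = _
      rw [e.left_inv hx.1]
      simp
    simp only [h2] at h1
    exact h1
  · obtain ⟨a, b, d, -, -, -, -, -, hf⟩ := hA e (IsManifold.chart_mem_maximalAtlas (c i))
    have h1 := (hSS i).hasSum_secondOrderExpr a b d (e x)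
    have h2 : (fun y => F (e.symm y)) =ᶠ[𝓝 (e x)] fun y => ∑' k, (ε k • G i k) y := hloc i x hx
    rw [hf F x hx.1, secondOrderExpr_congr a b d h2]
    convert h1 using 2 with k
    rw [← secondOrderExpr_congr a b d (hGx k), ← hf _ x hx.1, map_smul]
    simp

end Manifold

/-! ### Strictness off `K`, domination off `W`, and conclusion -/

section Manifold

variable {n : ℕ} {M : Type*} [TopologicalSpace M] [T2Space M] [LocallyConnectedSpace M]
  [ChartedSpace (EuclideanSpace ℝ (Fin n)) M] [IsManifold (𝓡 n) ∞ M]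
  {A : C^∞⟮𝓡 n, M; ℝ⟯ →ₗ[ℝ] (M → ℝ)}

/-- A global subsolution vanishing exactly on the first set of a filled exhaustion and locally
strict off it. -/
lemma IsLocallyUniformlyElliptic.exists_strict_subsolution [SecondCountableTopology M]
    (hA : IsLocallyUniformlyElliptic A)
    {κ : ℕ → Set M} (hc : ∀ j, IsCompact (κ j)) (hf : ∀ j, IsFilled (κ j))
    (hκ : ∀ j, κ j ⊆ interior (κ (j + 1))) (hcov : ∀ x, ∃ j, x ∈ κ j) :
    ∃ φ : C^∞⟮𝓡 n, M; ℝ⟯, (∀ x, 0 ≤ φ x) ∧ (∀ x, 0 ≤ A φ x) ∧ (∀ x ∈ κ 0, φ x = 0) ∧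
      (∀ x ∉ κ 0, 0 < φ x) ∧ ∀ E, IsCompact E → E ⊆ (κ 0)ᶜ → ∃ δ > 0, ∀ x ∈ E, δ ≤ A φ x := by
  rcases (κ 0)ᶜ.eq_empty_or_nonempty with hne | ⟨p₀, hp₀⟩
  · rw [compl_empty_iff] at hne
    refine ⟨0, by simp, by simp, by simp, fun x hx => absurd (hne ▸ mem_univ x) hx,
      fun E _ hE => ⟨1, one_pos, fun x hx => absurd (hne ▸ mem_univ x) (hE hx)⟩⟩
  have : Nonempty M := ⟨p₀⟩
  have hloc : ∀ p, ∃ φ : C^∞⟮𝓡 n, M; ℝ⟯, ∃ U : Set M, ∃ δ > 0, (∀ x, 0 ≤ φ x) ∧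
      (∀ x, 0 ≤ A φ x) ∧ (∀ x ∈ κ 0, φ x = 0) ∧ (∀ x ∈ U, δ ≤ φ x ∧ δ ≤ A φ x) ∧
      (p ∈ (κ 0)ᶜ → U ∈ 𝓝 p) := by
    intro p
    by_cases hp : p ∈ κ 0
    · exact ⟨0, ∅, 1, one_pos, by simp, by simp, by simp, by simp, fun h => absurd hp h⟩
    · obtain ⟨φ, h1, h2, h3, U, hU, δ, hδ, h4⟩ := hA.exists_subsolution hc hf hκ hcov hp
      exact ⟨φ, U, δ, hδ, h1, h2, h3, h4, fun _ => hU⟩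
  choose f U δ hδ hf0 hfA hfκ hfU hU using hloc
  obtain ⟨t, -, htc, htU⟩ := TopologicalSpace.countable_cover_nhdsWithin
    (f := fun p => interior (U p)) (s := (κ 0)ᶜ)
    fun p hp => mem_nhdsWithin_of_mem_nhds (interior_mem_nhds.2 (hU p hp))
  have htne : t.Nonempty := by
    obtain ⟨y, hy, -⟩ := mem_iUnion₂.1 (htU hp₀)
    exact ⟨y, hy⟩
  obtain ⟨c, rfl⟩ := htc.exists_eq_range htne
  have hcover : ∀ x ∉ κ 0, ∃ i, x ∈ interior (U (c i)) := by
    intro x hx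
    simpa using htU hx
  obtain ⟨ε, hε, F, hF⟩ := hA.exists_convergent_sum fun k => f (c k)
  -- All terms are nonnegative, so each sum dominates any single term.
  have hlow : ∀ x i, x ∈ U (c i) → ε i * δ (c i) ≤ F x ∧ ε i * δ (c i) ≤ A F x := by
    intro x i hx
    have h := hfU (c i) x hx
    exact ⟨(mul_le_mul_of_nonneg_left h.1 (hε i).le).trans
        (le_hasSum (hF x).1 i fun j _ => mul_nonneg (hε j).le (hf0 _ x)),
      (mul_le_mul_of_nonneg_left h.2 (hε i).le).trans
        (le_hasSum (hF x).2 i fun j _ => mul_nonneg (hε j).le (hfA _ x))⟩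
  refine ⟨F, fun x => (hF x).1.nonneg fun j => mul_nonneg (hε j).le (hf0 _ x),
    fun x => (hF x).2.nonneg fun j => mul_nonneg (hε j).le (hfA _ x), fun x hx => ?_,
    fun x hx => ?_, fun E hE hEκ => ?_⟩
  · refine (hF x).1.unique ?_
    simp only [hfκ _ x hx, mul_zero]
    exact hasSum_zero
  · obtain ⟨i, hi⟩ := hcover x hx
    exact (mul_pos (hε i) (hδ _)).trans_le (hlow x i (interior_subset hi)).1
  · refine hE.induction_on (p := fun E => ∃ δ > 0, ∀ x ∈ E, δ ≤ A F x) ⟨1, one_pos, by simp⟩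
      ?_ ?_ ?_
    · rintro S T hST ⟨d, hd, h⟩
      exact ⟨d, hd, fun x hx => h x (hST hx)⟩
    · rintro S T ⟨d, hd, h⟩ ⟨d', hd', h'⟩
      refine ⟨min d d', lt_min hd hd', ?_⟩
      rintro x (hx | hx)
      · exact (min_le_left _ _).trans (h x hx)
      · exact (min_le_right _ _).trans (h' x hx)
    · intro x hx
      obtain ⟨i, hi⟩ := hcover x (hEκ hx)
      exact ⟨U (c i), mem_nhdsWithin_of_mem_nhds (mem_interior_iff_mem_nhds.1 hi),
        ε i * δ (c i), mul_pos (hε i) (hδ _), fun y hy => (hlow y i hy).2⟩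

/-- A global subsolution vanishing on the first set of a filled exhaustion and dominating a given
continuous function off a neighborhood of that set. -/
lemma IsLocallyUniformlyElliptic.exists_dominating_subsolution
    (hA : IsLocallyUniformlyElliptic A)
    {κ : ℕ → Set M} (hc : ∀ j, IsCompact (κ j)) (hf : ∀ j, IsFilled (κ j))
    (hκ : ∀ j, κ j ⊆ interior (κ (j + 1))) (hcov : ∀ x, ∃ j, x ∈ κ j) {ρ : M → ℝ}
    (hρ : Continuous ρ) {W : Set M} (hW : W ∈ 𝓝ˢ (κ 0)) :
    ∃ φ : C^∞⟮𝓡 n, M; ℝ⟯, (∀ x, 0 ≤ φ x) ∧ (∀ x, 0 ≤ A φ x) ∧ (∀ x ∈ κ 0, φ x = 0) ∧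
      ∀ x ∉ W, ρ x < φ x ∧ ρ x < A φ x := by
  have hmono : Monotone κ := monotone_nat_of_le_succ fun j => (hκ j).trans interior_subset
  have hKW : κ 0 ⊆ interior W := subset_interior_iff_mem_nhdsSet.2 hW
  have hE : ∀ j, IsCompact (κ (j + 1) \ (interior (κ j) ∪ interior W)) := fun j =>
    (hc (j + 1)).diff (isOpen_interior.union isOpen_interior)
  choose B hB using fun j => (hE j).exists_bound_of_continuousOn hρ.continuousOn
  -- The exhaustion restarts at `κ (j - 1)`, which misses the shell: for `j > 0` it lies in
  -- `interior (κ j)`, while for `j = 0` truncated subtraction gives `κ 0 ⊆ interior W`. Vanishing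
  -- there makes the sum locally finite.
  have hψ : ∀ j, ∃ φ : C^∞⟮𝓡 n, M; ℝ⟯, (∀ x, 0 ≤ φ x) ∧ (∀ x, 0 ≤ A φ x) ∧
      (∀ x ∈ κ (j - 1), φ x = 0) ∧ ∀ x ∈ κ (j + 1) \ (interior (κ j) ∪ interior W),
        B j + 1 ≤ φ x ∧ B j + 1 ≤ A φ x := by
    intro j
    refine hA.exists_large_subsolution (κ := fun i => κ (j - 1 + i)) (fun i => hc _)
      (fun i => hf _) (fun i => hκ _) (fun x => ?_) (hE j) (fun x hx hx0 => ?_) (B j + 1)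
    · obtain ⟨i, hi⟩ := hcov x
      exact ⟨i, hmono (Nat.le_add_left _ _) hi⟩
    · rcases Nat.eq_zero_or_pos j with rfl | hj
      · exact hx.2 (Or.inr (hKW hx0))
      · refine hx.2 (Or.inl ?_)
        have := hκ (j - 1) hx0
        rwa [Nat.sub_add_cancel hj] at this
  choose ψ hψ0 hψA hψκ hψE using hψ
  obtain ⟨F, hF⟩ := hA.exists_locallyFinite_sum ψ (by
    intro x
    obtain ⟨k, hk⟩ := hcov x
    -- For `j ≥ k + 2` one has `k + 1 ≤ j - 1`, so `ψ j` vanishes on `κ (k + 1)`, a neighborhood of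
    -- `x`.
    refine ⟨k + 2, ?_⟩
    filter_upwards [isOpen_interior.mem_nhds (hκ k hk)] with y hy j hj
    exact hψκ j y (hmono (by omega) (interior_subset hy)))
  refine ⟨F, fun x => ?_, fun x => ?_, fun x hx => ?_, fun x hx => ?_⟩
  · obtain ⟨k, hk⟩ := hF x
    rw [(hk k le_rfl).1]
    exact Finset.sum_nonneg fun j _ => hψ0 j x
  · obtain ⟨k, hk⟩ := hF x
    rw [(hk k le_rfl).2.1]
    exact Finset.sum_nonneg fun j _ => hψA j x
  · obtain ⟨k, hk⟩ := hF x
    rw [(hk k le_rfl).1]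
    exact Finset.sum_eq_zero fun j _ => hψκ j x (hmono (Nat.zero_le _) hx)
  · have hxW : x ∉ interior W := fun h => hx (interior_subset h)
    classical
    have hex := hcov x
    -- The first member containing `x` has positive index since `κ 0 ⊆ W`; this locates the shell of
    -- `x`.
    obtain ⟨j, hj⟩ : ∃ j, Nat.find hex = j + 1 := Nat.exists_eq_succ_of_ne_zero fun h0 =>
      hxW (hKW (h0 ▸ Nat.find_spec hex))
    have hxj : x ∈ κ (j + 1) := hj ▸ Nat.find_spec hex
    have hxj' : x ∉ κ j := Nat.find_min hex (by omega)
    have hxE : x ∈ κ (j + 1) \ (interior (κ j) ∪ interior W) :=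
      ⟨hxj, fun h => h.elim (fun h => hxj' (interior_subset h)) hxW⟩
    have h1 := hψE j x hxE
    have h2 := (le_abs_self _).trans (hB j x hxE)
    obtain ⟨k, hk⟩ := hF x
    have hk' := hk (max k (j + 1)) (le_max_left _ _)
    have hjk : j ∈ Finset.range (max k (j + 1)) :=
      Finset.mem_range.2 ((Nat.lt_succ_self j).trans_le (le_max_right _ _))
    rw [hk'.1, hk'.2.1]
    have h3 := Finset.single_le_sum (f := fun j => ψ j x) (fun j _ => hψ0 j x) hjk
    have h4 := Finset.single_le_sum (f := fun j => A (ψ j) x) (fun j _ => hψA j x) hjk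
    constructor <;> linarith

end Manifold

theorem theorem1p10 {n : ℕ} {M : Type*} [TopologicalSpace M] [T2Space M]
    [SecondCountableTopology M] [ConnectedSpace M]
    [ChartedSpace (EuclideanSpace ℝ (Fin n)) M] [IsManifold (𝓡 n) ∞ M]
    (A : C^∞⟮𝓡 n, M; ℝ⟯ →ₗ[ℝ] (M → ℝ)) (hA : IsLocallyUniformlyElliptic A)
    (K : Set M) (hK : IsCompact K)
    (hKc : ∀ x ∈ Kᶜ, ¬ IsCompact (closure (connectedComponentIn Kᶜ x)))
    (ρ : M → ℝ) (hρ : Continuous ρ) (hρpos : ∀ x, 0 < ρ x)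
    (W : Set M) (hW : W ∈ 𝓝ˢ K) :
    ∃ φ : C^∞⟮𝓡 n, M; ℝ⟯,
      (∀ x, 0 ≤ φ x ∧ 0 ≤ A φ x) ∧
      (∀ x ∈ Wᶜ, ρ x < φ x ∧ ρ x < A φ x) ∧
      (∀ x ∈ K, φ x = 0) ∧
      (∀ x ∈ Kᶜ, 0 < φ x) ∧
      (∀ E : Set M, IsCompact E → E ⊆ Kᶜ → ∃ δ : ℝ, 0 < δ ∧ ∀ x ∈ E, δ < A φ x) := by
  have : LocallyCompactSpace M := ChartedSpace.locallyCompactSpace (EuclideanSpace ℝ (Fin n)) M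
  have : LocallyConnectedSpace M :=
    ChartedSpace.locallyConnectedSpace (EuclideanSpace ℝ (Fin n)) M
  obtain ⟨κ, rfl, hc, hf, hκ, hcov⟩ := IsFilled.exists_exhaustion hK hKc
  obtain ⟨φ, h1, h2, h3, h4, h5⟩ := hA.exists_strict_subsolution hc hf hκ hcov
  obtain ⟨ψ, g1, g2, g3, g4⟩ := hA.exists_dominating_subsolution hc hf hκ hcov hρ hW
  refine ⟨φ + ψ, fun x => ?_, fun x hx => ?_, fun x hx => ?_, fun x hx => ?_, fun E hE hEK => ?_⟩
  · simpa using ⟨add_nonneg (h1 x) (g1 x), add_nonneg (h2 x) (g2 x)⟩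
  · have := g4 x hx
    have := h1 x
    have := h2 x
    simp only [ContMDiffMap.coe_add, Pi.add_apply, map_add]
    constructor <;> linarith
  · simp [h3 x hx, g3 x hx]
  · simpa using add_pos_of_pos_of_nonneg (h4 x hx) (g1 x)
  · obtain ⟨δ, hδ, h⟩ := h5 E hE hEK
    refine ⟨δ / 2, half_pos hδ, fun x hx => ?_⟩
    have := h x hx
    have := g2 x
    simp only [map_add, Pi.add_apply]
    linarith
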